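/- Let $G(n,1/2)$ be the random graph on $[n]=\{1,\dots,n\}$ in which each pair is an edge independently with probability $1/2$. For a graph $G=([n],E)$ and an integer $r\ge 1$, the $r$-round SOS (Lasserre) relaxation of maximum clique asks for real vectors $U_S$ ($S\subseteq[n]$, $|S|\le r$), of any finite dimension, that maximize $\sum_{i\in[n]}\|U_{\{i\}}\|^2$ subject to - $\langle U_{\{i\}},U_{\{j\}}\rangle=0$ for all $i\neq j$ with $\{i,j\}\notin E$; - $\langle U_{S_1},U_{S_2}\rangle=\langle U_{S_3},U_{S_4}\rangle$ whenever $S_1\cup S_2=S_3\cup S_4$ and $|S_1\cup S_2|\le r$; - $\langle U_{S_1},U_{S_2}\rangle\in[0,1]$ for all $|S_1|,|S_2|\le r$; - $\|U_\emptyset\|^2=1$. Let $\mathrm{sos}_r(G)$ be the optimal value (supremum) of this program, and let $\mathrm{sos}^{*}_r(G)\le \mathrm{sos}_r(G)$ be the optimal value when the second constraint is strengthened to hold for all $S_1,S_2,S_3,S_4$ of size at most $r$ with $S_1\cup S_2=S_3\cup S_4$. Let $\omega(G)$ be the size of a largest clique of $G$. The integrality gaps of the two programs are $\mathrm{sos}_r(G)/\omega(G)$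 and $\mathrm{sos}^{*}_r(G)/\omega(G)$. **Theorem.** There is an absolute constant $C>0$ such that for every sequence of integers $r=r(n)\ge 1$, with probability tending to $1$ as $n\to\infty$ over $G\leftarrow G(n,1/2)$, both integrality gaps are at least $$\frac{n^{1/(2r)}}{C^{r}(\log n)^2}.$$ -/

import Mathlib

namespace MaxCliqueSOS

open Finset MeasureTheory

section Relaxation

variable {V : Type*} [Fintype V] [DecidableEq V]

/-- `U` is a feasible vector assignment for the `r`-round SOS relaxation of maximum clique on `G`.
The variables of the program are the vectors `U S` with `#S ≤ r`; the values of `U` on larger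
sets are not constrained and play no role. -/
structure IsSOSSolution (G : SimpleGraph V) (r : ℕ) {d : ℕ}
    (U : Finset V → EuclideanSpace ℝ (Fin d)) : Prop where
  nonadj : ∀ i j : V, i ≠ j → ¬ G.Adj i j → inner ℝ (U {i}) (U {j}) = 0
  consistent : ∀ S₁ S₂ S₃ S₄ : Finset V, S₁ ∪ S₂ = S₃ ∪ S₄ → #(S₁ ∪ S₂) ≤ r →
    inner ℝ (U S₁) (U S₂) = inner ℝ (U S₃) (U S₄)
  mem_Icc : ∀ S₁ S₂ : Finset V, #S₁ ≤ r → #S₂ ≤ r → inner ℝ (U S₁) (U S₂) ∈ Set.Icc (0 : ℝ) 1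
  norm_empty : ‖U ∅‖ ^ 2 = 1

/-- The program in which the consistency constraint is imposed on all sets of size at most `r`,
so that the inner products form a moment matrix of order `r` (a degree `2 * r`
pseudo-expectation). -/
structure IsFullSOSSolution (G : SimpleGraph V) (r : ℕ) {d : ℕ}
    (U : Finset V → EuclideanSpace ℝ (Fin d)) : Prop extends IsSOSSolution G r U where
  consistent_full : ∀ S₁ S₂ S₃ S₄ : Finset V, #S₁ ≤ r → #S₂ ≤ r → #S₃ ≤ r → #S₄ ≤ r →
    S₁ ∪ S₂ = S₃ ∪ S₄ → inner ℝ (U S₁) (U S₂) = inner ℝ (U S₃) (U S₄)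

/-- Objective values of feasible vector assignments, in any finite dimension. -/
def sosValues (G : SimpleGraph V) (r : ℕ) : Set ℝ :=
  {v | ∃ (d : ℕ) (U : Finset V → EuclideanSpace ℝ (Fin d)),
    IsSOSSolution G r U ∧ v = ∑ i : V, ‖U {i}‖ ^ 2}

/-- Objective values of feasible vector assignments for the fully consistent program. -/
def fullSOSValues (G : SimpleGraph V) (r : ℕ) : Set ℝ :=
  {v | ∃ (d : ℕ) (U : Finset V → EuclideanSpace ℝ (Fin d)),
    IsFullSOSSolution G r U ∧ v = ∑ i : V, ‖U {i}‖ ^ 2}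

theorem fullSOSValues_subset (G : SimpleGraph V) (r : ℕ) : fullSOSValues G r ⊆ sosValues G r := by
  rintro v ⟨d, U, hU, rfl⟩
  exact ⟨d, U, hU.toIsSOSSolution, rfl⟩

theorem bddAbove_sosValues (G : SimpleGraph V) {r : ℕ} (hr : 1 ≤ r) :
    BddAbove (sosValues G r) := by
  refine ⟨Fintype.card V, ?_⟩
  rintro v ⟨d, U, hU, rfl⟩
  have h : ∀ i ∈ (univ : Finset V), ‖U {i}‖ ^ 2 ≤ (1 : ℝ) := fun i _ => by
    have := (hU.mem_Icc {i} {i} (by simpa using hr) (by simpa using hr)).2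
    rwa [real_inner_self_eq_norm_sq] at this
  simpa using Finset.sum_le_sum h

theorem fullSOSValues_nonempty (G : SimpleGraph V) (r : ℕ) : (fullSOSValues G r).Nonempty := by
  refine ⟨_, 1, fun S => if S = ∅ then EuclideanSpace.single 0 1 else 0, ?_, rfl⟩
  have key : ∀ S T : Finset V, inner ℝ
      (if S = ∅ then EuclideanSpace.single 0 1 else 0 : EuclideanSpace ℝ (Fin 1))
      (if T = ∅ then EuclideanSpace.single 0 1 else 0) = if S ∪ T = ∅ then (1 : ℝ) else 0 := by
    intro S T
    by_cases hS : S = ∅ <;> by_cases hT : T = ∅ <;> simp [hS, hT, Finset.union_eq_empty]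
  refine { nonadj := ?_, consistent := ?_, mem_Icc := ?_, norm_empty := ?_, consistent_full := ?_ }
  · intro i j _ _
    simp
  · intro S₁ S₂ S₃ S₄ h _
    simp only [key, h]
  · intro S₁ S₂ _ _
    rw [key]
    split_ifs <;> simp
  · simp
  · intro S₁ S₂ S₃ S₄ _ _ _ _ h
    simp only [key, h]

/-- Optimum of the `r`-round SOS relaxation (for `1 ≤ r` a supremum of a non-empty bounded set). -/
noncomputable def sosValue (G : SimpleGraph V) (r : ℕ) : ℝ := sSup (sosValues G r)

/-- Optimum of the fully consistent `r`-round SOS relaxation. -/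
noncomputable def fullSOSValue (G : SimpleGraph V) (r : ℕ) : ℝ := sSup (fullSOSValues G r)

/-- Integrality gap: optimum of the relaxation over the size of a maximum clique. -/
noncomputable def integralityGap (G : SimpleGraph V) (r : ℕ) : ℝ :=
  sosValue G r / (G.cliqueNum : ℝ)

/-- Integrality gap of the fully consistent program. -/
noncomputable def fullIntegralityGap (G : SimpleGraph V) (r : ℕ) : ℝ :=
  fullSOSValue G r / (G.cliqueNum : ℝ)

end Relaxation

/-- The probability `1 / 2`, as an element of the unit interval. -/
noncomputable def half : unitInterval := ⟨1 / 2, by norm_num, by norm_num⟩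

/-- The random graph `G(n, 1/2)`. -/
noncomputable def randomGraph (n : ℕ) : Measure (SimpleGraph (Fin n)) :=
  SimpleGraph.binomialRandom (Fin n) half

end MaxCliqueSOS

/-! The witness is a pseudo-distribution: a clique `S` gets the moment `p ^ #S * 2 ^ (#S).choose 2`
with `p = k / n`, any other set gets `0`. Its objective value is `k`, so the work lies in showing
that the moment matrix on sets of size at most `r` is positive semidefinite for `k` about `n ^ (1 /
(2 * r))`, up to a factor exponential in `r`.

The moment of a union factors (`cliqueMoment_union`). After rescaling the test vector, the quadratic
form becomes the sum of `h S * h T * φ #(S ∩ T) * ∏ (1 + χ u v)`, the product running over `(S \ T)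
×ˢ (T \ S)`, where `φ i = (n / k) ^ i / 2 ^ i.choose 2` and `χ` is the `±1` adjacency matrix.
Replace `χ` by `t * χ` and let `t` run from `0` to `1`. Write `W = ∑ n ^ #S * h S ^ 2`.

At `t = 0` the form depends on overlaps only and is a sum of squares with positive coefficients;
Möbius inversion bounds it below by `W / (k ^ r * 2 ^ O(r ^ 2))` (`weighted_sq_le_sum_upSum_sq`).
Its derivative in `t` is a combination of bilinear forms of `χ`, hence at most `2 ^ O(r ^ 2) * (Λ /
n) * W` when `Λ` bounds the spectral norm (`abs_interpFormDeriv_le`). So the form at `t = 1` is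
nonnegative once `2 ^ O(r ^ 2) * Λ * k ^ r ≤ n` (`interpForm_one_nonneg`).

With high probability `Λ = 21 * √n` is admissible, by a net argument, and the clique number is at
most `33 * log n`, by a union bound. If the resulting `k` is below `1`, the trivial bound that the
gap is at least `1` suffices. -/

namespace MaxCliqueSOS

open Finset

/-! ### Möbius inversion over supersets and the averaged form -/

section Combinatorics

variable {V : Type*} [Fintype V] [DecidableEq V]

theorem sum_pow_card_sdiff (S : Finset V) (x : ℝ) :
    ∑ T : Finset V, x ^ #(T \ S) = 2 ^ #S * (1 + x) ^ #Sᶜ := by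
  have h1 : ∀ T : Finset V, x ^ #(T \ S) = ∏ i ∈ T, (if i ∈ S then 1 else x) := by
    intro T
    rw [Finset.prod_ite, Finset.prod_const_one, one_mul, Finset.prod_const]
    congr 2
    ext i
    simp
  have h2 := Finset.prod_one_add (f := fun i : V => if i ∈ S then (1 : ℝ) else x)
    (s := (univ : Finset V))
  rw [Finset.powerset_univ] at h2
  simp_rw [h1]
  rw [← h2]
  have h3 : ∀ i : V, (1 : ℝ) + (if i ∈ S then 1 else x) = if i ∈ S then 2 else 1 + x := by
    intro i
    split_ifs <;> norm_num
  simp_rw [h3]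
  rw [Finset.prod_ite, Finset.prod_const, Finset.prod_const]
  congr 3
  · ext i; simp
  · ext i; simp

/-- The decay `1 / n` per new element offsets the number of choices: `(1 + 1 / n) ^ n ≤ e < 3`. This
is the row sum in the later Cauchy–Schwarz and Schur-type estimates. -/
theorem sum_inv_card_pow_card_sdiff_le (S : Finset V) :
    ∑ T : Finset V, ((Fintype.card V : ℝ)⁻¹) ^ #(T \ S) ≤ 3 * 2 ^ #S := by
  rw [sum_pow_card_sdiff, mul_comm]
  gcongr
  set n := Fintype.card V
  rcases Nat.eq_zero_or_pos n with hn | hn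
  · simp only [hn, Nat.cast_zero, inv_zero, add_zero, one_pow]
    norm_num
  have hn' : (0 : ℝ) < n := by exact_mod_cast hn
  calc (1 + (n : ℝ)⁻¹) ^ #Sᶜ ≤ (1 + (n : ℝ)⁻¹) ^ n :=
        pow_le_pow_right₀ (by simp [hn'.le]) (Finset.card_le_univ _)
    _ ≤ (Real.exp (n : ℝ)⁻¹) ^ n := by
        gcongr
        rw [add_comm]
        exact Real.add_one_le_exp _
    _ = Real.exp 1 := by
        rw [← Real.exp_nat_mul, mul_inv_cancel₀ hn'.ne']
    _ ≤ 3 := Real.exp_one_lt_three.le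

theorem sum_interval_neg_one_pow (S T : Finset V) :
    ∑ J : Finset V, (if S ⊆ J ∧ J ⊆ T then (-1 : ℝ) ^ #(J \ S) else 0)
      = if S = T then 1 else 0 := by
  by_cases hST : S ⊆ T
  · rw [← Finset.sum_filter]
    have h1 : (univ.filter fun J : Finset V => S ⊆ J ∧ J ⊆ T)
        = (T \ S).powerset.image (S ∪ ·) := by
      rw [← Finset.Icc_eq_image_powerset hST]
      ext J
      simp
    rw [h1, Finset.sum_image]
    · have h2 : ∀ A ∈ (T \ S).powerset, (-1 : ℝ) ^ #((S ∪ A) \ S) = (-1) ^ #A := by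
        intro A hA
        congr 2
        rw [Finset.union_sdiff_left]
        refine Finset.sdiff_eq_self_of_disjoint (t := S) ?_
        exact Finset.disjoint_of_subset_left (Finset.mem_powerset.mp hA) Finset.sdiff_disjoint
      rw [Finset.sum_congr rfl h2]
      have h3 := Finset.sum_powerset_neg_one_pow_card (x := T \ S)
      have h4 : (∑ A ∈ (T \ S).powerset, (-1 : ℝ) ^ #A)
          = ((∑ A ∈ (T \ S).powerset, (-1 : ℤ) ^ #A : ℤ) : ℝ) := by
        push_cast
        rfl
      rw [h4, h3]
      have h5 : T \ S = ∅ ↔ S = T := by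
        rw [Finset.sdiff_eq_empty_iff_subset]
        exact ⟨fun h => hST.antisymm h, fun h => h ▸ Subset.rfl⟩
      simp [h5]
    · intro A hA B hB hAB
      have hA' := Finset.disjoint_of_subset_left (Finset.mem_powerset.mp hA)
        Finset.sdiff_disjoint
      have hB' := Finset.disjoint_of_subset_left (Finset.mem_powerset.mp hB)
        Finset.sdiff_disjoint
      have := congrArg (· \ S) hAB
      simpa [Finset.union_sdiff_left, Finset.sdiff_eq_self_of_disjoint hA',
        Finset.sdiff_eq_self_of_disjoint hB'] using this
  · have h1 : ∀ J : Finset V, ¬ (S ⊆ J ∧ J ⊆ T) := fun J h => hST (h.1.trans h.2)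
    have h2 : S ≠ T := fun h => hST (h ▸ Subset.rfl)
    simp [h1, h2]

/-- Sum of `h` over the supersets of `J`. -/
def upSum (h : Finset V → ℝ) (J : Finset V) : ℝ := ∑ T : Finset V, if J ⊆ T then h T else 0

theorem upSum_inversion (h : Finset V → ℝ) (S : Finset V) :
    h S = ∑ J : Finset V, if S ⊆ J then (-1) ^ #(J \ S) * upSum h J else 0 := by
  have h1 : ∀ J : Finset V, (if S ⊆ J then (-1) ^ #(J \ S) * upSum h J else 0)
      = ∑ T : Finset V, (if S ⊆ J ∧ J ⊆ T then (-1 : ℝ) ^ #(J \ S) else 0) * h T := by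
    intro J
    by_cases hJ : S ⊆ J
    · simp [hJ, upSum, Finset.mul_sum, ite_mul]
    · simp [hJ]
  simp_rw [h1]
  rw [Finset.sum_comm]
  simp_rw [← Finset.sum_mul, sum_interval_neg_one_pow]
  simp

theorem upSum_eq_zero {h : Finset V → ℝ} {r : ℕ} (hr : ∀ S, r < #S → h S = 0) {J : Finset V}
    (hJ : r < #J) : upSum h J = 0 := by
  refine Finset.sum_eq_zero fun T _ => ?_
  split_ifs with hJT
  · exact hr T (hJ.trans_le (Finset.card_le_card hJT))
  · rfl

/-- The binomial expansion of `φ #(S ∩ T)` is a sum of `c #J` over `J ⊆ S ∩ T`; exchanging sums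
decouples `S` from `T`. -/
theorem sum_overlap_eq_sum_upSum_sq (h : Finset V → ℝ) {φ c : ℕ → ℝ}
    (hφ : ∀ i, φ i = ∑ j ∈ range (i + 1), (i.choose j : ℝ) * c j) :
    ∑ S, ∑ T, h S * h T * φ #(S ∩ T) = ∑ J : Finset V, c #J * upSum h J ^ 2 := by
  have h1 : ∀ S T : Finset V, φ #(S ∩ T) = ∑ J : Finset V, if J ⊆ S ∧ J ⊆ T then c #J else 0 := by
    intro S T
    have h2 := Finset.sum_powerset_apply_card c (x := S ∩ T)
    rw [hφ, ← Finset.sum_filter]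
    simp only [nsmul_eq_mul] at h2
    rw [← h2]
    refine Finset.sum_congr ?_ fun _ _ => rfl
    ext J
    rw [Finset.mem_filter, Finset.mem_powerset, Finset.subset_inter_iff]
    simp
  have h2 : ∀ J : Finset V, c #J * upSum h J ^ 2
      = ∑ S, ∑ T, h S * h T * (if J ⊆ S ∧ J ⊆ T then c #J else 0) := by
    intro J
    rw [sq, upSum, Finset.sum_mul_sum, Finset.mul_sum]
    refine Finset.sum_congr rfl fun S _ => ?_
    rw [Finset.mul_sum]
    refine Finset.sum_congr rfl fun T _ => ?_
    by_cases hS : J ⊆ S <;> by_cases hT : J ⊆ T <;> simp [hS, hT]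
    ring
  simp_rw [h1, h2, Finset.mul_sum]
  conv_rhs => rw [Finset.sum_comm]
  refine Finset.sum_congr rfl fun S _ => ?_
  rw [Finset.sum_comm]

/-- Cauchy–Schwarz on the Möbius inversion with weights `q ^ (±#(J \ S))`, `q = n / k`. Since `1 / q
= k / n`, the row sum costs `k ^ (r - #S)`, and `n ^ #S = k ^ #S * q ^ #S` supplies the rest of `k ^
r`. -/
theorem sq_le_sum_upSum_sq {h : Finset V → ℝ} {r : ℕ} (hr : ∀ S, r < #S → h S = 0) {k : ℝ}
    (hk : 1 ≤ k) (hV : 0 < Fintype.card V) (S : Finset V) :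
    (Fintype.card V : ℝ) ^ #S * h S ^ 2 ≤ k ^ r * ∑ J : Finset V, if S ⊆ J then
      3 * 2 ^ r * ((Fintype.card V / k) ^ #J * upSum h J ^ 2) else 0 := by
  set n := Fintype.card V
  have hn : (0 : ℝ) < n := by exact_mod_cast hV
  have hk0 : 0 < k := by linarith
  set q : ℝ := n / k with hq
  have hq0 : 0 < q := by positivity
  by_cases hS : r < #S
  · rw [hr S hS]
    have : ∀ J : Finset V, 0 ≤ (if S ⊆ J then
      3 * 2 ^ r * (q ^ #J * upSum h J ^ 2) else 0 : ℝ) := by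
      intro J
      split_ifs <;> positivity
    have := Finset.sum_nonneg fun J (_ : J ∈ (univ : Finset (Finset V))) => this J
    have := mul_nonneg (pow_nonneg hk0.le r) this
    simpa using this
  push Not at hS
  set F := univ.filter fun J : Finset V => S ⊆ J ∧ #J ≤ r with hF
  have e1 : h S = ∑ J ∈ F, (-1) ^ #(J \ S) * upSum h J := by
    rw [upSum_inversion h S, hF, Finset.sum_filter]
    refine Finset.sum_congr rfl fun J _ => ?_
    by_cases hJ : #J ≤ r
    · simp [hJ]
    · push Not at hJ
      simp [upSum_eq_zero hr hJ]
  have e2 : h S ^ 2 ≤ (∑ J ∈ F, q⁻¹ ^ #(J \ S)) * ∑ J ∈ F, q ^ #(J \ S) * upSum h J ^ 2 := by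
    rw [e1]
    refine Finset.sum_sq_le_sum_mul_sum_of_sq_le_mul _ (fun J _ => by positivity)
      (fun J _ => by positivity) fun J _ => ?_
    refine le_of_eq ?_
    rw [← mul_assoc, ← mul_pow, inv_mul_cancel₀ hq0.ne', mul_pow, ← pow_mul]
    simp
  have e3 : ∑ J ∈ F, q⁻¹ ^ #(J \ S) ≤ k ^ (r - #S) * (3 * 2 ^ r) := by
    calc ∑ J ∈ F, q⁻¹ ^ #(J \ S) ≤ ∑ J ∈ F, k ^ (r - #S) * ((n : ℝ)⁻¹) ^ #(J \ S) := by
          refine Finset.sum_le_sum fun J hJ => ?_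
          rw [hF, Finset.mem_filter] at hJ
          have : q⁻¹ = k * (n : ℝ)⁻¹ := by rw [hq, inv_div]; rfl
          rw [this, mul_pow]
          gcongr
          rw [Finset.card_sdiff_of_subset hJ.2.1]
          omega
      _ ≤ ∑ J : Finset V, k ^ (r - #S) * ((n : ℝ)⁻¹) ^ #(J \ S) :=
          Finset.sum_le_sum_of_subset_of_nonneg (Finset.subset_univ _)
            fun J _ _ => by positivity
      _ ≤ k ^ (r - #S) * (3 * 2 ^ r) := by
          rw [← Finset.mul_sum]
          gcongr
          refine (sum_inv_card_pow_card_sdiff_le S).trans ?_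
          gcongr
          norm_num
  have hnS : (n : ℝ) ^ #S = k ^ #S * q ^ #S := by
    rw [← mul_pow, hq, mul_div_cancel₀ _ hk0.ne']
  calc (n : ℝ) ^ #S * h S ^ 2
      ≤ (n : ℝ) ^ #S * ((k ^ (r - #S) * (3 * 2 ^ r)) * ∑ J ∈ F, q ^ #(J \ S) * upSum h J ^ 2) := by
        gcongr
        refine e2.trans ?_
        gcongr
    _ = k ^ r * ∑ J ∈ F, 3 * 2 ^ r * (q ^ #J * upSum h J ^ 2) := by
        have hkr : k ^ r = k ^ #S * k ^ (r - #S) := by rw [← pow_add]; congr 1; omega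
        rw [hnS, hkr, Finset.mul_sum, Finset.mul_sum, Finset.mul_sum]
        refine Finset.sum_congr rfl fun J hJ => ?_
        rw [hF, Finset.mem_filter] at hJ
        have : q ^ #J = q ^ #S * q ^ #(J \ S) := by
          rw [← pow_add, Finset.card_sdiff_of_subset hJ.2.1]
          congr 1
          have := Finset.card_le_card hJ.2.1
          omega
        rw [this]
        ring
    _ ≤ _ := by
        gcongr
        rw [← Finset.sum_filter]
        refine Finset.sum_le_sum_of_subset_of_nonneg ?_ fun J _ _ => by positivity
        intro J hJ
        rw [hF, Finset.mem_filter] at hJ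
        simp [hJ.2.1]

theorem weighted_sq_le_sum_upSum_sq {h : Finset V → ℝ} {r : ℕ} (hr : ∀ S, r < #S → h S = 0)
    {k : ℝ} (hk : 1 ≤ k) (hV : 0 < Fintype.card V) :
    ∑ S, (Fintype.card V : ℝ) ^ #S * h S ^ 2 ≤
      k ^ r * (3 * 2 ^ (2 * r) * ∑ J : Finset V, (Fintype.card V / k) ^ #J * upSum h J ^ 2) := by
  refine (Finset.sum_le_sum fun S _ => sq_le_sum_upSum_sq hr hk hV S).trans ?_
  rw [← Finset.mul_sum, Finset.sum_comm]
  have hk0 : 0 < k := by linarith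
  gcongr
  rw [Finset.mul_sum]
  refine Finset.sum_le_sum fun J _ => ?_
  by_cases hJ : r < #J
  · simp [upSum_eq_zero hr hJ]
  push Not at hJ
  -- After exchanging sums, each `J` is counted once per subset `S`, which costs the second factor
  -- `2 ^ r`.
  rw [← Finset.sum_filter, Finset.sum_const]
  have : (univ.filter fun S : Finset V => S ⊆ J) = J.powerset := by ext; simp
  rw [this, Finset.card_powerset, nsmul_eq_mul]
  push_cast
  have : (2 : ℝ) ^ #J ≤ 2 ^ r := pow_le_pow_right₀ (by norm_num) hJ
  calc (2 : ℝ) ^ #J * (3 * 2 ^ r * ((Fintype.card V / k) ^ #J * upSum h J ^ 2))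
      ≤ (2 : ℝ) ^ r * (3 * 2 ^ r * ((Fintype.card V / k) ^ #J * upSum h J ^ 2)) := by gcongr
    _ = _ := by ring

end Combinatorics

/-! ### Iterated differences of a fast-growing sequence -/

section ForwardDifferences

/-- When `φ` grows by at least `1 / ε` per step, its top value dominates every iterated difference:
each differencing subtracts a nonnegative quantity that is at most `ε` times the top value. -/
theorem fwdDiff_iter_bounds {φ : ℕ → ℝ} {r : ℕ} {ε : ℝ} (hε : 0 ≤ ε) (hεr : r * ε ≤ 1)
    (hφ0 : ∀ x, 0 ≤ φ x) (hφ : ∀ x < r, φ x ≤ ε * φ (x + 1)) (j : ℕ) :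
    ∀ x, x + j ≤ r → (1 - j * ε) * φ (x + j) ≤ (fwdDiff 1)^[j] φ x ∧ (fwdDiff 1)^[j] φ x ≤ φ (x + j) := by
  induction j with
  | zero => intro x _; simp
  | succ j ih =>
    intro x hx
    rw [Function.iterate_succ_apply', fwdDiff]
    have h0 := ih x (by omega)
    have h1 := ih (x + 1) (by omega)
    have h2 := hφ (x + j) (by omega)
    have e : x + 1 + j = x + (j + 1) := by omega
    have e' : x + j + 1 = x + (j + 1) := by omega
    rw [e] at h1
    rw [e'] at h2
    have hj : (j : ℝ) * ε ≤ 1 := by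
      refine le_trans ?_ hεr
      gcongr
      omega
    have h3 : 0 ≤ (fwdDiff 1)^[j] φ x := le_trans (mul_nonneg (by linarith) (hφ0 _)) h0.1
    push_cast
    constructor <;> nlinarith [hφ0 (x + (j + 1))]

theorem eq_sum_choose_mul_fwdDiff (φ : ℕ → ℝ) (i : ℕ) :
    φ i = ∑ j ∈ range (i + 1), (i.choose j : ℝ) * (fwdDiff 1)^[j] φ 0 := by
  have := shift_eq_sum_fwdDiff_iter (h := 1) φ i 0
  simpa using this

end ForwardDifferences

end MaxCliqueSOS

namespace MaxCliqueSOS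

open Finset

/-! ### Interpolating from the averaged form to the actual one -/

section Interpolation

theorem insert_sdiff_insert_of_notMem {V : Type*} [DecidableEq V] {S T : Finset V} {u v : V}
    (hu : u ∉ T) (hv : v ∉ S) (huv : u ≠ v) :
    insert u S \ insert v T = insert u (S \ T) := by
  rw [Finset.insert_sdiff_of_notMem _ (by simp [huv, hu]), Finset.sdiff_insert_of_notMem hv]

theorem prod_erase_insert_product {V : Type*} [DecidableEq V] {A B : Finset V} {u v : V} (hu : u ∉ A) (hv : v ∉ B)
    (f : V → V → ℝ) :
    ∏ e ∈ ((insert u A) ×ˢ (insert v B)).erase (u, v), f e.1 e.2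
      = (∏ e ∈ A ×ˢ B, f e.1 e.2) * (∏ b ∈ B, f u b) * ∏ a ∈ A, f a v := by
  have h1 : ((insert u A) ×ˢ (insert v B)).erase (u, v) = A ×ˢ B ∪ ({u} ×ˢ B ∪ A ×ˢ {v}) := by
    ext ⟨x, y⟩
    simp only [mem_erase, mem_product, mem_insert, mem_union, mem_singleton, ne_eq, Prod.mk.injEq]
    constructor
    · rintro ⟨h, rfl | h1, rfl | h2⟩ <;> simp_all
    · rintro (⟨h1, h2⟩ | ⟨rfl, h2⟩ | ⟨h1, rfl⟩)
      · exact ⟨fun h => hu (h.1 ▸ h1), Or.inr h1, Or.inr h2⟩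
      · exact ⟨fun h => hv (h.2 ▸ h2), Or.inl rfl, Or.inr h2⟩
      · exact ⟨fun h => hu (h.1 ▸ h1), Or.inr h1, Or.inl rfl⟩
  rw [h1, Finset.prod_union, Finset.prod_union]
  · rw [mul_assoc]
    congr 1
    simp
  · rw [Finset.disjoint_left]
    rintro ⟨x, y⟩ h h'
    simp only [mem_product, mem_singleton] at h h'
    exact hu (h.1 ▸ h'.1)
  · rw [Finset.disjoint_left]
    rintro ⟨x, y⟩ h h'
    simp only [mem_product, mem_singleton, mem_union] at h h'
    rcases h' with h' | h'
    · exact hu (h'.1 ▸ h.1)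
    · exact hv (h'.2 ▸ h.2)

/-- Weighted AM–GM, arranged so that each square carries a weight summable over the other set. -/
theorem pow_card_inter_mul_le {V : Type*} [DecidableEq V] (X Y : Finset V → ℝ) {n : ℝ} (hn : 0 < n) (S T : Finset V) :
    n ^ #(S ∩ T) * (X S * Y T) ≤ (n⁻¹ ^ #(T \ S) * (n ^ #S * X S ^ 2)
      + n⁻¹ ^ #(S \ T) * (n ^ #T * Y T ^ 2)) / 2 := by
  have hS : n ^ #S = n ^ #(S ∩ T) * n ^ #(S \ T) := by
    rw [← pow_add, Finset.card_inter_add_card_sdiff]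
  have hT : n ^ #T = n ^ #(S ∩ T) * n ^ #(T \ S) := by
    rw [← pow_add, Finset.inter_comm, Finset.card_inter_add_card_sdiff]
  rw [hS, hT, inv_pow, inv_pow]
  set a := n ^ #(S \ T) with ha
  set b := n ^ #(T \ S) with hb
  have ha0 : 0 < a := by positivity
  have hb0 : 0 < b := by positivity
  have key : X S * Y T ≤ (b⁻¹ * (a * X S ^ 2) + a⁻¹ * (b * Y T ^ 2)) / 2 := by
    have : (b⁻¹ * (a * X S ^ 2) + a⁻¹ * (b * Y T ^ 2)) / 2 - X S * Y T
        = (a * X S - b * Y T) ^ 2 / (2 * a * b) := by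
      field_simp
      ring
    have h2 : 0 ≤ (a * X S - b * Y T) ^ 2 / (2 * a * b) := by positivity
    linarith
  calc n ^ #(S ∩ T) * (X S * Y T)
      ≤ n ^ #(S ∩ T) * ((b⁻¹ * (a * X S ^ 2) + a⁻¹ * (b * Y T ^ 2)) / 2) := by gcongr
    _ = _ := by ring

variable {V : Type*} [Fintype V] [DecidableEq V]

/-- Product of the interpolated edge factors `1 + t * χ u v` over `A × B`. -/
noncomputable def crossProd (χ : V → V → ℝ) (t : ℝ) (A B : Finset V) : ℝ :=
  ∏ e ∈ A ×ˢ B, (1 + t * χ e.1 e.2)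

/-- Interpolation between the averaged quadratic form (`t = 0`) and the actual one (`t = 1`). -/
noncomputable def interpForm (χ : V → V → ℝ) (φ : ℕ → ℝ) (h : Finset V → ℝ) (t : ℝ) : ℝ :=
  ∑ S, ∑ T, h S * h T * φ #(S ∩ T) * crossProd χ t (S \ T) (T \ S)

/-- The derivative of `interpForm`. -/
noncomputable def interpFormDeriv (χ : V → V → ℝ) (φ : ℕ → ℝ) (h : Finset V → ℝ) (t : ℝ) : ℝ :=
  ∑ S, ∑ T, h S * h T * φ #(S ∩ T) *
    ∑ e ∈ (S \ T) ×ˢ (T \ S), (∏ e' ∈ ((S \ T) ×ˢ (T \ S)).erase e, (1 + t * χ e'.1 e'.2)) *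
      χ e.1 e.2

theorem hasDerivAt_interpForm (χ : V → V → ℝ) (φ : ℕ → ℝ) (h : Finset V → ℝ) (t : ℝ) :
    HasDerivAt (interpForm χ φ h) (interpFormDeriv χ φ h t) t := by
  unfold interpForm interpFormDeriv crossProd
  refine HasDerivAt.fun_sum fun S _ => HasDerivAt.fun_sum fun T _ => ?_
  refine HasDerivAt.const_mul _ ?_
  have := HasDerivAt.fun_finsetProd (u := (S \ T) ×ˢ (T \ S))
    (f := fun e (t : ℝ) => 1 + t * χ e.1 e.2) (f' := fun e => χ e.1 e.2) (x := t)
    (fun e _ => by simpa using ((hasDerivAt_id t).mul_const (χ e.1 e.2)).const_add 1)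
  simpa [smul_eq_mul] using this

theorem sum_mem_eq_sum_insert (f : Finset V → V → ℝ) :
    ∑ S : Finset V, ∑ u, (if u ∈ S then f S u else 0)
      = ∑ S : Finset V, ∑ u, if u ∈ S then 0 else f (insert u S) u := by
  rw [Finset.sum_comm]
  conv_rhs => rw [Finset.sum_comm]
  refine Finset.sum_congr rfl fun u _ => ?_
  rw [← Finset.sum_filter]
  have : ∀ S : Finset V, (if u ∈ S then 0 else f (insert u S) u)
      = if u ∉ S then f (insert u S) u else 0 := by
    intro S
    split_ifs <;> simp_all
  simp_rw [this]
  rw [← Finset.sum_filter]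
  refine Finset.sum_nbij' (fun S => S.erase u) (fun S => insert u S) ?_ ?_ ?_ ?_ ?_
  · intro S _; simp
  · intro S _; simp
  · intro S hS; exact Finset.insert_erase (by simpa using hS)
  · intro S hS; exact Finset.erase_insert (by simpa using hS)
  · intro S hS
    rw [Finset.insert_erase (by simpa using hS)]

/-- The vector `u ↦ h (S ∪ {u})`, damped by the factors of the edges from `u` to `T \ S`. -/
noncomputable def linkVec (χ : V → V → ℝ) (t : ℝ) (h : Finset V → ℝ) (S T : Finset V) (u : V) : ℝ :=
  if u ∈ S ∪ T then 0 else h (insert u S) * ∏ v ∈ T \ S, (1 + t * χ u v)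

/-- The norm of `u ↦ h (S ∪ {u})` over `u ∉ S`. -/
noncomputable def linkNorm (h : Finset V → ℝ) (S : Finset V) : ℝ :=
  √(∑ u, if u ∈ S then 0 else h (insert u S) ^ 2)

/-- Differentiation singles out one cross pair `(u, v)`. Detaching `u` from `S` and `v` from `T`
leaves `S ∩ T` unchanged, and the remaining factors split into those between the reduced sets, those
at `u` and those at `v`. For fixed reduced sets this is a bilinear form in `χ`, to which a spectral
bound applies. -/
theorem interpFormDeriv_eq {χ : V → V → ℝ} (hsymm : ∀ u v, χ u v = χ v u) (hdiag : ∀ u, χ u u = 0)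
    (φ : ℕ → ℝ) (h : Finset V → ℝ) (t : ℝ) :
    interpFormDeriv χ φ h t = ∑ S, ∑ T, φ #(S ∩ T) * crossProd χ t (S \ T) (T \ S) *
      ∑ u, ∑ v, χ u v * linkVec χ t h S T u * linkVec χ t h T S v := by
  set F : Finset V → V → Finset V → V → ℝ := fun S u T v => if u ∉ T ∧ v ∉ S then
    h S * h T * φ #(S ∩ T) *
    ((∏ e' ∈ ((S \ T) ×ˢ (T \ S)).erase (u, v), (1 + t * χ e'.1 e'.2)) * χ u v) else 0 with hF
  have h1 : interpFormDeriv χ φ h t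
      = ∑ S : Finset V, ∑ u, if u ∈ S then
          (∑ T : Finset V, ∑ v, if v ∈ T then F S u T v else 0) else 0 := by
    unfold interpFormDeriv
    refine Finset.sum_congr rfl fun S _ => ?_
    rw [← Finset.sum_filter, Finset.sum_comm]
    refine Finset.sum_congr rfl fun T _ => ?_
    rw [Finset.mul_sum, Finset.sum_product]
    have e1 : S \ T = (univ.filter (· ∈ S)).filter (· ∉ T) := by ext; simp
    conv_lhs => rw [e1, Finset.sum_filter]
    refine Finset.sum_congr rfl fun u hu => ?_
    by_cases huT : u ∈ T
    · simp [hF, huT]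
    rw [if_pos huT, ← e1]
    have e2 : T \ S = (univ.filter (· ∈ T)).filter (· ∉ S) := by ext; simp
    rw [← Finset.sum_filter]
    conv_lhs => rw [e2, Finset.sum_filter]
    refine Finset.sum_congr rfl fun v hv => ?_
    rw [← e2]
    simp [hF, huT]
  rw [h1, sum_mem_eq_sum_insert (fun S u => ∑ T : Finset V, ∑ v, if v ∈ T then F S u T v else 0)]
  have h2 : ∀ (S : Finset V) (u : V), (∑ T : Finset V, ∑ v, if v ∈ T then F S u T v else 0)
      = ∑ T : Finset V, ∑ v, if v ∈ T then 0 else F S u (insert v T) v := fun S u =>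
    sum_mem_eq_sum_insert (fun T v => F S u T v)
  simp_rw [h2]
  refine Finset.sum_congr rfl fun S _ => ?_
  have h3 : ∀ u : V, (if u ∈ S then (0 : ℝ) else
      ∑ T : Finset V, ∑ v, if v ∈ T then 0 else F (insert u S) u (insert v T) v)
      = ∑ T : Finset V, ∑ v, if u ∈ S ∨ v ∈ T then 0 else F (insert u S) u (insert v T) v := by
    intro u
    by_cases hu : u ∈ S <;> simp [hu]
  simp_rw [h3]
  rw [Finset.sum_comm]
  refine Finset.sum_congr rfl fun T _ => ?_
  rw [Finset.mul_sum]
  refine Finset.sum_congr rfl fun u _ => ?_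
  rw [Finset.mul_sum]
  refine Finset.sum_congr rfl fun v _ => ?_
  by_cases huS : u ∈ S
  · simp [huS, linkVec]
  by_cases hvT : v ∈ T
  · simp [hvT, linkVec]
  by_cases huT : u ∈ T
  · simp [huT, linkVec, hF]
  by_cases hvS : v ∈ S
  · simp [hvS, linkVec, hF]
  by_cases huv : u = v
  · subst huv
    simp [hF, hdiag]
  have hvu : v ≠ u := fun h => huv h.symm
  have i1 : insert u S \ insert v T = insert u (S \ T) := insert_sdiff_insert_of_notMem huT hvS huv
  have i2 : insert v T \ insert u S = insert v (T \ S) := insert_sdiff_insert_of_notMem hvS huT hvu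
  have i3 : insert u S ∩ insert v T = S ∩ T := by
    rw [Finset.insert_inter_of_notMem (by simp [huv, huT]), Finset.inter_insert_of_notMem hvS]
  have c1 : u ∉ insert v T ∧ v ∉ insert u S := by simp [huv, huT, hvu, hvS]
  have c2 : u ∉ S ∪ T := by simp [huS, huT]
  have c3 : v ∉ T ∪ S := by simp [hvS, hvT]
  simp only [hF, huS, hvT, or_self, if_false, if_pos c1, i1, i2, i3, linkVec, if_neg c2, if_neg c3]
  rw [prod_erase_insert_product (by simp [huS]) (by simp [hvT]) (fun x y => 1 + t * χ x y)]
  have : ∏ a ∈ S \ T, (1 + t * χ a v) = ∏ a ∈ S \ T, (1 + t * χ v a) :=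
    Finset.prod_congr rfl fun a _ => by rw [hsymm]
  rw [this, crossProd]
  ring

theorem abs_one_add_mul_le {t x : ℝ} (ht : t ∈ Set.Icc (0 : ℝ) 1) (hx : |x| ≤ 1) :
    |1 + t * x| ≤ 2 := by
  have h1 := abs_add_le 1 (t * x)
  rw [abs_mul, abs_one, abs_of_nonneg ht.1] at h1
  nlinarith [ht.1, ht.2, abs_nonneg x]

theorem abs_prod_one_add_mul_le {ι : Type*} (s : Finset ι) {t : ℝ} (ht : t ∈ Set.Icc (0 : ℝ) 1)
    {x : ι → ℝ} (hx : ∀ i, |x i| ≤ 1) : |∏ i ∈ s, (1 + t * x i)| ≤ 2 ^ #s := by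
  rw [Finset.abs_prod, ← Finset.prod_const]
  exact Finset.prod_le_prod (fun i _ => abs_nonneg _) fun i _ => abs_one_add_mul_le ht (hx i)

theorem norm_linkVec_le {χ : V → V → ℝ} (hχ : ∀ u v, |χ u v| ≤ 1) {t : ℝ}
    (ht : t ∈ Set.Icc (0 : ℝ) 1) (h : Finset V → ℝ) (S T : Finset V) :
    √(∑ u, linkVec χ t h S T u ^ 2) ≤ 2 ^ #(T \ S) * linkNorm h S := by
  have h0 : (2 : ℝ) ^ #(T \ S) * linkNorm h S
      = √((2 ^ #(T \ S)) ^ 2 * ∑ u, if u ∈ S then 0 else h (insert u S) ^ 2) := by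
    rw [Real.sqrt_mul (by positivity), Real.sqrt_sq (by positivity), linkNorm]
  rw [h0]
  refine Real.sqrt_le_sqrt ?_
  rw [Finset.mul_sum]
  refine Finset.sum_le_sum fun u _ => ?_
  unfold linkVec
  by_cases hu : u ∈ S
  · simp [hu]
  rw [if_neg hu]
  by_cases hu' : u ∈ T
  · rw [if_pos (by simp [hu'])]
    simp only [ne_eq, OfNat.ofNat_ne_zero, not_false_eq_true, zero_pow]
    positivity
  rw [if_neg (by simp [hu, hu']), mul_pow, mul_comm]
  refine mul_le_mul_of_nonneg_right ?_ (sq_nonneg _)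
  rw [← sq_abs]
  exact pow_le_pow_left₀ (abs_nonneg _) (abs_prod_one_add_mul_le _ ht (fun v => hχ u v)) 2

theorem linkNorm_nonneg (h : Finset V → ℝ) (S : Finset V) : 0 ≤ linkNorm h S := Real.sqrt_nonneg _

theorem linkNorm_sq (h : Finset V → ℝ) (S : Finset V) :
    linkNorm h S ^ 2 = ∑ u, if u ∈ S then 0 else h (insert u S) ^ 2 := by
  refine Real.sq_sqrt (Finset.sum_nonneg fun u _ => ?_)
  split_ifs <;> positivity

theorem linkNorm_eq_zero {h : Finset V → ℝ} {r : ℕ} (hr : ∀ S, r < #S → h S = 0) {S : Finset V}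
    (hS : r ≤ #S) : linkNorm h S = 0 := by
  rw [← sq_eq_zero_iff, linkNorm_sq]
  refine Finset.sum_eq_zero fun u _ => ?_
  split_ifs with hu
  · rfl
  · rw [hr _ (by rw [Finset.card_insert_of_notMem hu]; omega)]
    simp

/-- Each set arises from at most `r` choices of a detached element, and detaching lowers the weight
by a factor `n`. This gain of `1 / n` is what beats the spectral norm. -/
theorem sum_pow_mul_linkNorm_sq_le {h : Finset V → ℝ} {r : ℕ} (hr : ∀ S, r < #S → h S = 0)
    {n : ℝ} (hn : 0 < n) :
    ∑ S, n ^ #S * linkNorm h S ^ 2 ≤ r / n * ∑ S, n ^ #S * h S ^ 2 := by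
  have h1 : ∀ S : Finset V, n ^ #S * linkNorm h S ^ 2
      = ∑ u, if u ∈ S then 0 else n ^ #(insert u S) / n * h (insert u S) ^ 2 := by
    intro S
    rw [linkNorm_sq, Finset.mul_sum]
    refine Finset.sum_congr rfl fun u _ => ?_
    split_ifs with hu
    · simp
    · rw [Finset.card_insert_of_notMem hu, pow_succ n, mul_div_cancel_right₀ _ hn.ne']
  simp_rw [h1]
  rw [← sum_mem_eq_sum_insert (fun S _ => n ^ #S / n * h S ^ 2), Finset.mul_sum]
  refine Finset.sum_le_sum fun S _ => ?_
  rw [← Finset.sum_filter, Finset.sum_const, nsmul_eq_mul]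
  by_cases hS : r < #S
  · simp [hr S hS]
  push Not at hS
  have h2 : (#(univ.filter (· ∈ S)) : ℝ) ≤ r := by
    have : univ.filter (· ∈ S) = S := by ext; simp
    rw [this]
    exact_mod_cast hS
  calc (#(univ.filter (· ∈ S)) : ℝ) * (n ^ #S / n * h S ^ 2)
      ≤ r * (n ^ #S / n * h S ^ 2) := by gcongr
    _ = _ := by ring

theorem sum_pow_card_inter_mul_le {X : Finset V → ℝ} {r : ℕ} (hr : ∀ S, r < #S → X S = 0)
    (hV : 0 < Fintype.card V) :
    ∑ S, ∑ T, (Fintype.card V : ℝ) ^ #(S ∩ T) * (X S * X T)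
      ≤ 3 * 2 ^ r * ∑ S, (Fintype.card V : ℝ) ^ #S * X S ^ 2 := by
  set n := Fintype.card V
  have hn : (0 : ℝ) < n := by exact_mod_cast hV
  set B : ℝ := ∑ S : Finset V, ∑ T : Finset V, (n : ℝ)⁻¹ ^ #(T \ S) * ((n : ℝ) ^ #S * X S ^ 2)
    with hB
  have h1 : ∑ S, ∑ T, (n : ℝ) ^ #(S ∩ T) * (X S * X T) ≤ (B + B) / 2 := by
    have : (B + B) / 2 = ∑ S : Finset V, ∑ T : Finset V,
        ((n : ℝ)⁻¹ ^ #(T \ S) * ((n : ℝ) ^ #S * X S ^ 2)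
          + (n : ℝ)⁻¹ ^ #(S \ T) * ((n : ℝ) ^ #T * X T ^ 2)) / 2 := by
      simp_rw [← Finset.sum_div, Finset.sum_add_distrib]
      congr 2
      rw [hB, Finset.sum_comm]
    rw [this]
    exact Finset.sum_le_sum fun S _ => Finset.sum_le_sum fun T _ =>
      pow_card_inter_mul_le X X hn S T
  refine h1.trans ?_
  rw [add_self_div_two, hB, Finset.mul_sum]
  refine Finset.sum_le_sum fun S _ => ?_
  rw [← Finset.sum_mul]
  by_cases hS : r < #S
  · simp [hr S hS]
  push Not at hS
  gcongr
  refine (sum_inv_card_pow_card_sdiff_le S).trans ?_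
  gcongr
  norm_num

/-- The spectral bound handles each pair of reduced sets; summing over pairs is a Schur test on the
link norms. -/
theorem abs_interpFormDeriv_le {χ : V → V → ℝ} (hsymm : ∀ u v, χ u v = χ v u)
    (hdiag : ∀ u, χ u u = 0) (hχ : ∀ u v, |χ u v| ≤ 1) {Λ : ℝ} (hΛ0 : 0 ≤ Λ)
    (hΛ : ∀ x y : V → ℝ, |∑ u, ∑ v, χ u v * x u * y v| ≤ Λ * √(∑ u, x u ^ 2) * √(∑ v, y v ^ 2))
    {φ : ℕ → ℝ} (hφ0 : ∀ i, 0 ≤ φ i) (hφ : ∀ i, φ i ≤ (Fintype.card V : ℝ) ^ i)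
    {h : Finset V → ℝ} {r : ℕ} (hr : ∀ S, r < #S → h S = 0) (hV : 0 < Fintype.card V)
    {t : ℝ} (ht : t ∈ Set.Icc (0 : ℝ) 1) :
    |interpFormDeriv χ φ h t| ≤
      2 ^ (r ^ 2) * Λ * (3 * 2 ^ r * (r / (Fintype.card V : ℝ) *
        ∑ S, (Fintype.card V : ℝ) ^ #S * h S ^ 2)) := by
  set n := Fintype.card V
  have hn : (0 : ℝ) < n := by exact_mod_cast hV
  have hterm : ∀ S T : Finset V, |φ #(S ∩ T) * crossProd χ t (S \ T) (T \ S) *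
      ∑ u, ∑ v, χ u v * linkVec χ t h S T u * linkVec χ t h T S v|
      ≤ 2 ^ (r ^ 2) * Λ * ((n : ℝ) ^ #(S ∩ T) * (linkNorm h S * linkNorm h T)) := by
    intro S T
    have b1 : |crossProd χ t (S \ T) (T \ S)| ≤ 2 ^ (#(S \ T) * #(T \ S)) := by
      rw [← Finset.card_product]
      exact abs_prod_one_add_mul_le _ ht (fun e : V × V => hχ e.1 e.2)
    have b2 : |∑ u, ∑ v, χ u v * linkVec χ t h S T u * linkVec χ t h T S v|
        ≤ Λ * (2 ^ #(T \ S) * linkNorm h S) * (2 ^ #(S \ T) * linkNorm h T) := by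
      refine (hΛ _ _).trans ?_
      gcongr
      · exact mul_nonneg hΛ0 (mul_nonneg (by positivity) (linkNorm_nonneg _ _))
      · exact norm_linkVec_le hχ ht h S T
      · exact norm_linkVec_le hχ ht h T S
    have b3 : |φ #(S ∩ T) * crossProd χ t (S \ T) (T \ S) *
      ∑ u, ∑ v, χ u v * linkVec χ t h S T u * linkVec χ t h T S v|
      ≤ (n : ℝ) ^ #(S ∩ T) * 2 ^ (#(S \ T) * #(T \ S)) *
        (Λ * (2 ^ #(T \ S) * linkNorm h S) * (2 ^ #(S \ T) * linkNorm h T)) := by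
      rw [abs_mul, abs_mul, abs_of_nonneg (hφ0 _)]
      gcongr
      exact hφ _
    refine b3.trans ?_
    by_cases hS : r ≤ #S
    · simp [linkNorm_eq_zero hr hS]
    by_cases hT : r ≤ #T
    · simp [linkNorm_eq_zero hr hT]
    push Not at hS hT
    have ha : #(S \ T) + 1 ≤ r := lt_of_le_of_lt (Finset.card_le_card Finset.sdiff_subset) hS
    have hb : #(T \ S) + 1 ≤ r := lt_of_le_of_lt (Finset.card_le_card Finset.sdiff_subset) hT
    -- Reduced sets have fewer than `r` elements, so with `a` and `b` the two difference sizes, `a *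
    -- b + a + b < (a + 1) * (b + 1) ≤ r ^ 2`.
    have b4 : (2 : ℝ) ^ (#(S \ T) * #(T \ S) + #(T \ S) + #(S \ T)) ≤ 2 ^ (r ^ 2) := by
      refine pow_le_pow_right₀ (by norm_num) ?_
      nlinarith [Nat.mul_le_mul ha hb]
    have hX := linkNorm_nonneg h S
    have hY := linkNorm_nonneg h T
    calc (n : ℝ) ^ #(S ∩ T) * 2 ^ (#(S \ T) * #(T \ S)) *
        (Λ * (2 ^ #(T \ S) * linkNorm h S) * (2 ^ #(S \ T) * linkNorm h T))
        = 2 ^ (#(S \ T) * #(T \ S) + #(T \ S) + #(S \ T)) * (Λ *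
          ((n : ℝ) ^ #(S ∩ T) * (linkNorm h S * linkNorm h T))) := by
          rw [pow_add, pow_add]
          ring
      _ ≤ 2 ^ (r ^ 2) * (Λ * ((n : ℝ) ^ #(S ∩ T) * (linkNorm h S * linkNorm h T))) := by
          gcongr
      _ = _ := by ring
  rw [interpFormDeriv_eq hsymm hdiag]
  refine (Finset.abs_sum_le_sum_abs _ _).trans ?_
  refine (Finset.sum_le_sum fun S _ => Finset.abs_sum_le_sum_abs _ _).trans ?_
  refine (Finset.sum_le_sum fun S _ => Finset.sum_le_sum fun T _ => hterm S T).trans ?_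
  simp_rw [← Finset.mul_sum]
  gcongr
  refine (sum_pow_card_inter_mul_le (X := linkNorm h) (r := r)
    (fun S hS => linkNorm_eq_zero hr hS.le) hV).trans ?_
  gcongr
  exact sum_pow_mul_linkNorm_sq_le hr hn

end Interpolation

end MaxCliqueSOS

namespace MaxCliqueSOS

open Finset

/-! ### Clique moments and the sign matrix -/

section SignMatrix

theorem crossProd_zero {V : Type*} (χ : V → V → ℝ) (A B : Finset V) : crossProd χ 0 A B = 1 := by
  simp [crossProd]

variable {V : Type*} [DecidableEq V]

open scoped Classical in
/-- The `±1` adjacency matrix of `G`, with zero diagonal. -/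
noncomputable def signMatrix (G : SimpleGraph V) (u v : V) : ℝ :=
  if u = v then 0 else if G.Adj u v then 1 else -1

theorem signMatrix_symm (G : SimpleGraph V) (u v : V) : signMatrix G u v = signMatrix G v u := by
  unfold signMatrix
  by_cases h : u = v
  · simp [h]
  by_cases h' : G.Adj u v
  · simp [h, Ne.symm h, h', h'.symm]
  · have h'' : ¬ G.Adj v u := fun a => h' a.symm
    simp [h, Ne.symm h, h', h'']

theorem signMatrix_diag (G : SimpleGraph V) (u : V) : signMatrix G u u = 0 := by
  simp [signMatrix]

theorem abs_signMatrix_le (G : SimpleGraph V) (u v : V) : |signMatrix G u v| ≤ 1 := by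
  unfold signMatrix
  split_ifs <;> simp

theorem crossProd_signMatrix_of_isClique {G : SimpleGraph V} {A B : Finset V}
    (h : ∀ u ∈ A, ∀ v ∈ B, G.Adj u v) : crossProd (signMatrix G) 1 A B = 2 ^ (#A * #B) := by
  rw [crossProd, ← Finset.card_product]
  refine Finset.prod_eq_pow_card fun e he => ?_
  rw [Finset.mem_product] at he
  have hne : e.1 ≠ e.2 := (h _ he.1 _ he.2).ne
  rw [signMatrix, if_neg hne, if_pos (h _ he.1 _ he.2)]
  norm_num

theorem crossProd_signMatrix_of_not_adj {G : SimpleGraph V} {A B : Finset V} {u v : V}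
    (hu : u ∈ A) (hv : v ∈ B) (huv : u ≠ v) (h : ¬ G.Adj u v) :
    crossProd (signMatrix G) 1 A B = 0 := by
  refine Finset.prod_eq_zero (i := (u, v)) (by simp [hu, hv]) ?_
  simp [signMatrix, huv, h]

theorem choose_two_add (a b : ℕ) : (a + b).choose 2 = a.choose 2 + b.choose 2 + a * b := by
  induction b with
  | zero => simp
  | succ b ih =>
    rw [← add_assoc, Nat.choose_succ_succ', ih, Nat.choose_succ_succ' b]
    simp
    ring

/-- The weight `q ^ i / 2 ^ (i.choose 2)`. -/
noncomputable def overlapWeight (q : ℝ) (i : ℕ) : ℝ := q ^ i / 2 ^ i.choose 2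

/-- The moment of a clique of size `i`: an independent `p`-random set, reweighted by the inverse
probability that its pairs are edges. -/
noncomputable def cliqueWeight (p : ℝ) (i : ℕ) : ℝ := p ^ i * 2 ^ i.choose 2

open scoped Classical in
/-- The moments of the pseudo-expectation. -/
noncomputable def cliqueMoment (G : SimpleGraph V) (p : ℝ) (S : Finset V) : ℝ :=
  if G.IsClique (S : Set V) then cliqueWeight p #S else 0

/-- For cliques `S` and `T`, only pairs between `S \ T` and `T \ S` can be missing, and `crossProd`
at `t = 1` is `2` per present pair and vanishes if one is absent. The overlap weight corrects the
double counting of `S ∩ T`. -/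
theorem cliqueMoment_union (G : SimpleGraph V) {p : ℝ} (hp : p ≠ 0) (S T : Finset V) :
    cliqueMoment G p (S ∪ T) = cliqueMoment G p S * cliqueMoment G p T *
      overlapWeight p⁻¹ #(S ∩ T) * crossProd (signMatrix G) 1 (S \ T) (T \ S) := by
  by_cases hS : G.IsClique (S : Set V)
  swap
  · have : ¬ G.IsClique ((S ∪ T : Finset V) : Set V) := fun h =>
      hS (h.subset (by simp))
    simp only [cliqueMoment, if_neg hS, if_neg this, zero_mul]
  by_cases hT : G.IsClique (T : Set V)
  swap
  · have : ¬ G.IsClique ((S ∪ T : Finset V) : Set V) := fun h =>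
      hT (h.subset (by simp))
    simp only [cliqueMoment, if_neg hT, if_neg this, zero_mul, mul_zero]
  have hne : ∀ u ∈ S \ T, ∀ v ∈ T \ S, u ≠ v := by
    rintro u hu v hv rfl
    simp only [mem_sdiff] at hu hv
    exact hu.2 hv.1
  by_cases hU : G.IsClique ((S ∪ T : Finset V) : Set V)
  · rw [crossProd_signMatrix_of_isClique]
    · simp only [cliqueMoment, if_pos hS, if_pos hT, if_pos hU, cliqueWeight, overlapWeight]
      have e1 : #S = #(S ∩ T) + #(S \ T) := (Finset.card_inter_add_card_sdiff S T).symm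
      have e2 : #T = #(S ∩ T) + #(T \ S) := by
        rw [Finset.inter_comm]
        exact (Finset.card_inter_add_card_sdiff T S).symm
      have e3 : #(S ∪ T) = #(S ∩ T) + #(S \ T) + #(T \ S) := by
        have := Finset.card_union_add_card_inter S T
        omega
      rw [e1, e2, e3]
      set i := #(S ∩ T)
      set a := #(S \ T)
      set b := #(T \ S)
      rw [choose_two_add (i + a) b, choose_two_add i a, choose_two_add i b, add_mul]
      simp only [pow_add, inv_pow]
      have h2 : (2 : ℝ) ^ i.choose 2 ≠ 0 := by positivity
      have hpi : p ^ i ≠ 0 := pow_ne_zero _ hp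
      field_simp
    · intro u hu v hv
      exact hU (by simp [(mem_sdiff.mp hu).1]) (by simp [(mem_sdiff.mp hv).1]) (hne u hu v hv)
  · have : ∃ u ∈ S \ T, ∃ v ∈ T \ S, ¬ G.Adj u v := by
      by_contra hcon
      push Not at hcon
      refine hU fun u hu v hv huv => ?_
      simp only [coe_union, Set.mem_union, mem_coe] at hu hv
      by_cases hu1 : u ∈ S <;> by_cases hv1 : v ∈ S
      · exact hS hu1 hv1 huv
      · have hv2 : v ∈ T := by simpa [hv1] using hv
        by_cases hu2 : u ∈ T
        · exact hT hu2 hv2 huv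
        · exact hcon u (by simp [hu1, hu2]) v (by simp [hv1, hv2])
      · have hu2 : u ∈ T := by simpa [hu1] using hu
        by_cases hv2 : v ∈ T
        · exact hT hu2 hv2 huv
        · exact (hcon v (by simp [hv1, hv2]) u (by simp [hu1, hu2])).symm
      · exact hT (by simpa [hu1] using hu) (by simpa [hv1] using hv) huv
    obtain ⟨u, hu, v, hv, huv⟩ := this
    rw [crossProd_signMatrix_of_not_adj hu hv (hne u hu v hv) huv, mul_zero]
    simp only [cliqueMoment, if_neg hU]

end SignMatrix

/-! ### From positive moment matrices to the value of the program -/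

section Relaxation

variable {V : Type*} [Fintype V] [DecidableEq V]

theorem exists_gram_vectors {ι : Type*} [Fintype ι] {A : ι → ι → ℝ} (hA : ∀ i j, A i j = A j i)
    (hpos : ∀ x : ι → ℝ, 0 ≤ ∑ i, ∑ j, A i j * x i * x j) :
    ∃ (d : ℕ) (U : ι → EuclideanSpace ℝ (Fin d)), ∀ i j, inner ℝ (U i) (U j) = A i j := by
  have h1 : (Matrix.of A).PosSemidef := by
    refine Matrix.PosSemidef.of_dotProduct_mulVec_nonneg ?_ fun x => ?_
    · ext i j
      simp [hA i j]
    · refine (hpos x).trans_eq ?_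
      simp only [dotProduct, Matrix.mulVec, Finset.mul_sum, Matrix.of_apply, Pi.star_apply,
        star_trivial]
      refine Finset.sum_congr rfl fun i _ => Finset.sum_congr rfl fun j _ => ?_
      ring
  obtain ⟨d, v, hv⟩ := Matrix.posSemidef_iff_eq_sum_vecMulVec.mp h1
  refine ⟨d, fun i => WithLp.toLp 2 fun a => v a i, fun i j => ?_⟩
  have h2 : A i j = (Matrix.of A) i j := rfl
  rw [h2, hv, Matrix.sum_apply]
  simp [Matrix.vecMulVec_apply, PiLp.inner_apply, mul_comm]

theorem bddAbove_fullSOSValues (G : SimpleGraph V) {r : ℕ} (hr : 1 ≤ r) :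
    BddAbove (fullSOSValues G r) :=
  (bddAbove_sosValues G hr).mono (fullSOSValues_subset G r)

theorem fullSOSValue_le_sosValue (G : SimpleGraph V) {r : ℕ} (hr : 1 ≤ r) :
    fullSOSValue G r ≤ sosValue G r :=
  csSup_le_csSup (bddAbove_sosValues G hr) (fullSOSValues_nonempty G r) (fullSOSValues_subset G r)

theorem fullIntegralityGap_le_integralityGap (G : SimpleGraph V) {r : ℕ} (hr : 1 ≤ r) :
    fullIntegralityGap G r ≤ integralityGap G r :=
  div_le_div_of_nonneg_right (fullSOSValue_le_sosValue G hr) (Nat.cast_nonneg _)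

/-- A pseudo-expectation given by its moments bounds the fully consistent program from below. -/
theorem sum_moments_le_fullSOSValue (G : SimpleGraph V) {r : ℕ} (hr : 1 ≤ r) {m : Finset V → ℝ}
    (hpos : ∀ x : Finset V → ℝ,
      0 ≤ ∑ S, ∑ T, (if #S ≤ r ∧ #T ≤ r then m (S ∪ T) else 0) * x S * x T)
    (hempty : m ∅ = 1) (hadj : ∀ i j, i ≠ j → ¬ G.Adj i j → m {i, j} = 0)
    (hmem : ∀ S, #S ≤ 2 * r → m S ∈ Set.Icc (0 : ℝ) 1) :
    ∑ i, m {i} ≤ fullSOSValue G r := by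
  obtain ⟨d, U, hU⟩ := exists_gram_vectors
    (A := fun S T : Finset V => if #S ≤ r ∧ #T ≤ r then m (S ∪ T) else 0)
    (fun S T => by simp only [and_comm, Finset.union_comm]) hpos
  have hU' : ∀ S T : Finset V, #S ≤ r → #T ≤ r → inner ℝ (U S) (U T) = m (S ∪ T) := by
    intro S T hS hT
    rw [hU]
    simp [hS, hT]
  have hsol : IsFullSOSSolution G r U := by
    refine { nonadj := ?_, consistent := ?_, mem_Icc := ?_, norm_empty := ?_,
             consistent_full := ?_ }
    · intro i j hij hG
      rw [hU' _ _ (by simpa using hr) (by simpa using hr)]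
      exact hadj i j hij hG
    · intro S₁ S₂ S₃ S₄ h hc
      have hc' : #(S₃ ∪ S₄) ≤ r := h ▸ hc
      rw [hU' _ _ ((card_le_card subset_union_left).trans hc)
          ((card_le_card subset_union_right).trans hc),
        hU' _ _ ((card_le_card subset_union_left).trans hc')
          ((card_le_card subset_union_right).trans hc'), h]
    · intro S₁ S₂ h₁ h₂
      rw [hU' _ _ h₁ h₂]
      exact hmem _ ((card_union_le _ _).trans (by omega))
    · rw [← real_inner_self_eq_norm_sq, hU' _ _ (by simp) (by simp)]
      simpa using hempty
    · intro S₁ S₂ S₃ S₄ h₁ h₂ h₃ h₄ h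
      rw [hU' _ _ h₁ h₂, hU' _ _ h₃ h₄, h]
  refine le_csSup (bddAbove_fullSOSValues G hr) ⟨d, U, hsol, ?_⟩
  refine Finset.sum_congr rfl fun i _ => ?_
  rw [← real_inner_self_eq_norm_sq, hU' _ _ (by simpa using hr) (by simpa using hr),
    Finset.union_self]

/-- The integral solution of a maximum clique `Q`: its moment matrix is the rank-one matrix of the
indicator of `S ⊆ Q`. -/
theorem cliqueNum_le_fullSOSValue (G : SimpleGraph V) {r : ℕ} (hr : 1 ≤ r) :
    (G.cliqueNum : ℝ) ≤ fullSOSValue G r := by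
  obtain ⟨Q, hQ⟩ := G.exists_isNClique_cliqueNum
  have key := sum_moments_le_fullSOSValue G hr (m := fun S => if S ⊆ Q then (1 : ℝ) else 0)
    ?_ ?_ ?_ ?_
  · refine le_trans (le_of_eq ?_) key
    rw [← hQ.card_eq]
    simp
  · intro x
    have : ∑ S : Finset V, ∑ T : Finset V,
        (if #S ≤ r ∧ #T ≤ r then (if S ∪ T ⊆ Q then (1 : ℝ) else 0) else 0) * x S * x T
        = (∑ S : Finset V, if #S ≤ r ∧ S ⊆ Q then x S else 0) ^ 2 := by
      rw [sq, Finset.sum_mul_sum]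
      refine Finset.sum_congr rfl fun S _ => Finset.sum_congr rfl fun T _ => ?_
      simp only [Finset.union_subset_iff]
      by_cases h1 : #S ≤ r <;> by_cases h2 : #T ≤ r <;> by_cases h3 : S ⊆ Q <;>
        by_cases h4 : T ⊆ Q <;> simp [h1, h2, h3, h4]
    rw [this]
    positivity
  · simp
  · intro i j hij hG
    refine if_neg fun h => hG ?_
    exact hQ.isClique (h (by simp)) (h (by simp)) hij
  · intro S _
    split_ifs <;> simp

theorem overlapWeight_succ (q : ℝ) (i : ℕ) :
    overlapWeight q (i + 1) = overlapWeight q i * (q / 2 ^ i) := by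
  rw [overlapWeight, overlapWeight, choose_two_add, pow_add, pow_succ]
  simp only [pow_add]
  field_simp
  simp

theorem interpForm_one_nonneg {χ : V → V → ℝ} (hsymm : ∀ u v, χ u v = χ v u)
    (hdiag : ∀ u, χ u u = 0) (hχ : ∀ u v, |χ u v| ≤ 1) {Λ : ℝ} (hΛ1 : 1 ≤ Λ)
    (hΛ : ∀ x y : V → ℝ, |∑ u, ∑ v, χ u v * x u * y v| ≤ Λ * √(∑ u, x u ^ 2) * √(∑ v, y v ^ 2))
    {r : ℕ} (hr1 : 1 ≤ r) {k : ℝ} (hk : 1 ≤ k)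
    (hmain : 18 * r * 2 ^ (2 * r ^ 2 + 3 * r) * Λ * k ^ r ≤ Fintype.card V)
    {h : Finset V → ℝ} (hr : ∀ S, r < #S → h S = 0) :
    0 ≤ interpForm χ (overlapWeight (Fintype.card V / k)) h 1 := by
  set n := Fintype.card V with hn_def
  have hk0 : 0 < k := by linarith
  have hr0 : (1 : ℝ) ≤ r := by exact_mod_cast hr1
  have hn : (0 : ℝ) < n := by
    refine lt_of_lt_of_le ?_ hmain
    positivity
  have hV : 0 < Fintype.card V := by exact_mod_cast hn
  set q : ℝ := n / k with hq
  have hq0 : 0 < q := by positivity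
  set φ := overlapWeight q with hφ_def
  have hφpos : ∀ i, 0 < φ i := fun i => by rw [hφ_def, overlapWeight]; positivity
  have hφle : ∀ i, φ i ≤ (n : ℝ) ^ i := by
    intro i
    rw [hφ_def, overlapWeight]
    refine (div_le_self (by positivity) (one_le_pow₀ (by norm_num))).trans ?_
    gcongr
    exact div_le_self hn.le hk
  set W := ∑ S, (n : ℝ) ^ #S * h S ^ 2 with hW
  have hW0 : 0 ≤ W := Finset.sum_nonneg fun S _ => by positivity
  have hkr : k ≤ k ^ r := le_self_pow₀ hk (by omega)
  have hqbig : 2 * r * 2 ^ r ≤ q := by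
    rw [hq, le_div_iff₀ hk0]
    refine le_trans ?_ hmain
    have e1 : (2 : ℝ) ^ r ≤ 2 ^ (2 * r ^ 2 + 3 * r) := pow_le_pow_right₀ (by norm_num) (by nlinarith)
    calc 2 * r * 2 ^ r * k ≤ 18 * r * 2 ^ (2 * r ^ 2 + 3 * r) * 1 * k ^ r := by
          rw [mul_one]
          gcongr
          norm_num
      _ ≤ 18 * r * 2 ^ (2 * r ^ 2 + 3 * r) * Λ * k ^ r := by gcongr
  -- The ratio `φ x / φ (x + 1)` equals `2 ^ x / q`, so `ε` bounds it for all `x < r`.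
  set ε : ℝ := 2 ^ r / q with hε
  have hrε : r * ε ≤ 1 / 2 := by
    rw [hε, mul_div_assoc', div_le_iff₀ hq0]
    linarith
  have hstep : ∀ x < r, φ x ≤ ε * φ (x + 1) := by
    intro x hx
    rw [hφ_def, overlapWeight_succ, hε]
    have h2 : (2 : ℝ) ^ x ≤ 2 ^ r := pow_le_pow_right₀ (by norm_num) hx.le
    have h3 : 2 ^ r / q * (overlapWeight q x * (q / 2 ^ x))
        = overlapWeight q x * (2 ^ r / 2 ^ x) := by
      field_simp
    rw [h3]
    refine le_mul_of_one_le_right (hφpos x).le ?_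
    rwa [one_le_div (by positivity)]
  set c : ℕ → ℝ := fun j => (fwdDiff 1)^[j] φ 0 with hc
  have hc_lower : ∀ j ≤ r, q ^ j / (2 * 2 ^ (r ^ 2)) ≤ c j := by
    intro j hj
    have h1 := (fwdDiff_iter_bounds (ε := ε) (by positivity) (by linarith)
      (fun x => (hφpos x).le) hstep j 0 (by omega)).1
    rw [zero_add] at h1
    refine le_trans ?_ h1
    have h2 : (1 : ℝ) / 2 ≤ 1 - j * ε := by
      have : (j : ℝ) * ε ≤ r * ε := by
        gcongr
      linarith
    have h3 : q ^ j / 2 ^ (r ^ 2) ≤ φ j := by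
      rw [hφ_def, overlapWeight]
      gcongr
      · norm_num
      · calc j.choose 2 ≤ j ^ 2 := Nat.choose_le_pow j 2
          _ ≤ r ^ 2 := by gcongr
    calc q ^ j / (2 * 2 ^ (r ^ 2)) = 1 / 2 * (q ^ j / 2 ^ (r ^ 2)) := by field_simp
      _ ≤ (1 - j * ε) * φ j := by gcongr
  have hbase : W ≤ k ^ r * (3 * 2 ^ (2 * r) * (2 * 2 ^ (r ^ 2))) * interpForm χ φ h 0 := by
    have h0 : interpForm χ φ h 0 = ∑ J : Finset V, c #J * upSum h J ^ 2 := by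
      rw [← sum_overlap_eq_sum_upSum_sq h (φ := φ) (eq_sum_choose_mul_fwdDiff φ)]
      simp [interpForm, crossProd_zero]
    refine (weighted_sq_le_sum_upSum_sq hr hk hV).trans ?_
    rw [h0, mul_assoc (k ^ r), mul_assoc (3 * 2 ^ (2 * r) : ℝ)]
    gcongr
    rw [Finset.mul_sum]
    refine Finset.sum_le_sum fun J _ => ?_
    by_cases hJ : r < #J
    · simp [upSum_eq_zero hr hJ]
    push Not at hJ
    have := hc_lower _ hJ
    rw [div_le_iff₀ (by positivity)] at this
    calc q ^ #J * upSum h J ^ 2 ≤ (c #J * (2 * 2 ^ (r ^ 2))) * upSum h J ^ 2 := by gcongr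
      _ = _ := by ring
  have hderiv : ∀ t ∈ Set.Ico (0 : ℝ) 1, ‖interpFormDeriv χ φ h t‖ ≤
      2 ^ (r ^ 2) * Λ * (3 * 2 ^ r * (r / (n : ℝ) * W)) := fun t ht =>
    abs_interpFormDeriv_le hsymm hdiag hχ (by linarith) hΛ (fun i => (hφpos i).le) hφle hr hV
      ⟨ht.1, ht.2.le⟩
  have hmvt := norm_image_sub_le_of_norm_deriv_le_segment_01'
    (fun t _ => (hasDerivAt_interpForm χ φ h t).hasDerivWithinAt) hderiv
  rw [Real.norm_eq_abs] at hmvt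
  have hg0 : 0 ≤ interpForm χ φ h 0 := by
    by_contra hneg
    push Not at hneg
    have : k ^ r * (3 * 2 ^ (2 * r) * (2 * 2 ^ (r ^ 2))) * interpForm χ φ h 0 < 0 :=
      mul_neg_of_pos_of_neg (by positivity) hneg
    linarith
  -- The total change along the segment is absorbed by the value at `t = 0`; the product of the two
  -- estimates is where `18 = 3 * 3 * 2` and the exponent `2 * r ^ 2 + 3 * r` come from.
  have hE : 2 ^ (r ^ 2) * Λ * (3 * 2 ^ r * (r / (n : ℝ) * W)) ≤ interpForm χ φ h 0 := by
    calc 2 ^ (r ^ 2) * Λ * (3 * 2 ^ r * (r / (n : ℝ) * W))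
        ≤ 2 ^ (r ^ 2) * Λ * (3 * 2 ^ r * (r / (n : ℝ) *
          (k ^ r * (3 * 2 ^ (2 * r) * (2 * 2 ^ (r ^ 2))) * interpForm χ φ h 0))) := by
          gcongr
      _ = (18 * r * 2 ^ (2 * r ^ 2 + 3 * r) * Λ * k ^ r) / n * interpForm χ φ h 0 := by
          have : (2 : ℝ) ^ (2 * r ^ 2 + 3 * r)
              = 2 ^ (r ^ 2) * 2 ^ (r ^ 2) * (2 ^ r * 2 ^ (2 * r)) := by
            rw [← pow_add, ← pow_add, ← pow_add]
            congr 1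
            ring
          rw [this]
          ring
      _ ≤ 1 * interpForm χ φ h 0 := by
          gcongr
          rwa [div_le_one hn]
      _ = _ := one_mul _
  have := (abs_le.mp hmvt).1
  linarith

theorem le_fullSOSValue (G : SimpleGraph V) {Λ : ℝ} (hΛ1 : 1 ≤ Λ)
    (hΛ : ∀ x y : V → ℝ, |∑ u, ∑ v, signMatrix G u v * x u * y v|
      ≤ Λ * √(∑ u, x u ^ 2) * √(∑ v, y v ^ 2))
    {r : ℕ} (hr1 : 1 ≤ r) {k : ℝ} (hk : 1 ≤ k)
    (hmain : 18 * r * 2 ^ (2 * r ^ 2 + 3 * r) * Λ * k ^ r ≤ Fintype.card V) :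
    k ≤ fullSOSValue G r := by
  set n := Fintype.card V with hn_def
  have hk0 : 0 < k := by linarith
  have hr0 : (1 : ℝ) ≤ r := by exact_mod_cast hr1
  have hn : (0 : ℝ) < n := by
    refine lt_of_lt_of_le ?_ hmain
    positivity
  have hkr : k ≤ k ^ r := le_self_pow₀ hk (by omega)
  set p : ℝ := k / n with hp
  have hp0 : 0 < p := by positivity
  have hpinv : p⁻¹ = n / k := by rw [hp, inv_div]
  have hp2 : p * 2 ^ r ≤ 1 := by
    rw [hp, div_mul_eq_mul_div, div_le_one hn]
    refine le_trans ?_ hmain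
    have e1 : (2 : ℝ) ^ r ≤ 2 ^ (2 * r ^ 2 + 3 * r) := pow_le_pow_right₀ (by norm_num) (by nlinarith)
    calc k * 2 ^ r ≤ k ^ r * 2 ^ (2 * r ^ 2 + 3 * r) := by gcongr
      _ = (1 * 1) * 2 ^ (2 * r ^ 2 + 3 * r) * 1 * k ^ r := by ring
      _ ≤ 18 * r * 2 ^ (2 * r ^ 2 + 3 * r) * Λ * k ^ r := by
        gcongr
        norm_num
  have key := sum_moments_le_fullSOSValue G hr1 (m := cliqueMoment G p) ?_ ?_ ?_ ?_
  · refine le_trans (le_of_eq ?_) key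
    simp only [cliqueMoment, cliqueWeight, coe_singleton, SimpleGraph.isClique_singleton, if_true,
      card_singleton, pow_one, Nat.choose_succ_self, pow_zero, mul_one, sum_const, card_univ,
      nsmul_eq_mul]
    rw [← hn_def, hp, mul_div_cancel₀ _ hn.ne']
  · intro x
    have := interpForm_one_nonneg (signMatrix_symm G) (signMatrix_diag G) (abs_signMatrix_le G)
      hΛ1 hΛ hr1 hk hmain
      (h := fun S => if #S ≤ r then cliqueMoment G p S * x S else 0)
      (fun S hS => if_neg (by omega))
    refine this.trans_eq ?_
    unfold interpForm
    refine Finset.sum_congr rfl fun S _ => Finset.sum_congr rfl fun T _ => ?_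
    by_cases hS : #S ≤ r <;> by_cases hT : #T ≤ r <;> simp only [hS, hT, if_true, if_false,
      zero_mul, mul_zero, and_self, and_true, and_false]
    rw [cliqueMoment_union G hp0.ne', hpinv]
    ring
  · simp [cliqueMoment, cliqueWeight]
  · intro i j hij hG
    refine if_neg fun h => hG ?_
    exact h (by simp) (by simp) hij
  · intro S hS
    unfold cliqueMoment
    split_ifs with h
    · refine ⟨by unfold cliqueWeight; positivity, ?_⟩
      unfold cliqueWeight
      -- As `#S ≤ 2 * r`, each element contributes at most `2 ^ r`, so the moment is at most `(p * 2
      -- ^ r) ^ #S ≤ 1`.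
      have e1 : (#S).choose 2 ≤ r * #S := by
        rw [Nat.choose_two_right]
        refine Nat.div_le_of_le_mul ?_
        calc #S * (#S - 1) ≤ #S * (2 * r) := by gcongr; omega
          _ = 2 * (r * #S) := by ring
      calc p ^ #S * 2 ^ (#S).choose 2 ≤ p ^ #S * 2 ^ (r * #S) := by
            gcongr
            norm_num
        _ = (p * 2 ^ r) ^ #S := by rw [mul_pow, ← pow_mul]
        _ ≤ 1 := pow_le_one₀ (by positivity) hp2
    · simp

end Relaxation

end MaxCliqueSOS

namespace MaxCliqueSOS

open Finset MeasureTheory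

/-! ### Exponential moments for the uniform random graph -/

section RandomGraph

instance measurableSingletonClass_simpleGraph {V : Type*} [Countable V] :
    MeasurableSingletonClass (SimpleGraph V) := by
  refine ⟨fun G => ?_⟩
  have h : ({G} : Set (SimpleGraph V)) = SimpleGraph.Adj ⁻¹' {G.Adj} := by
    ext H
    simp
  rw [h]
  exact SimpleGraph.measurable_adj (measurableSet_singleton _)

instance isProbabilityMeasure_randomGraph (n : ℕ) : IsProbabilityMeasure (randomGraph n) :=
  inferInstanceAs (IsProbabilityMeasure (SimpleGraph.binomialRandom (Fin n) half))

open scoped Classical in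
-- Independence of the edges in product form: graphs correspond to sets of non-diagonal pairs.
theorem sum_simpleGraph_prod (n : ℕ) (a b : Sym2 (Fin n) → ℝ) :
    ∑ G : SimpleGraph (Fin n), ∏ e ∈ univ.filter (fun e : Sym2 (Fin n) => ¬ e.IsDiag),
        (if e ∈ G.edgeSet then a e else b e)
      = ∏ e ∈ univ.filter (fun e : Sym2 (Fin n) => ¬ e.IsDiag), (a e + b e) := by
  rw [Finset.prod_add]
  refine Finset.sum_bij' (fun G _ => univ.filter fun e => e ∈ G.edgeSet)
    (fun t _ => SimpleGraph.fromEdgeSet (t : Set (Sym2 (Fin n)))) ?_ ?_ ?_ ?_ ?_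
  · intro G _
    rw [Finset.mem_powerset]
    intro e he
    simp only [mem_filter, mem_univ, true_and] at he ⊢
    exact G.not_isDiag_of_mem_edgeSet he
  · intro t _
    exact mem_univ _
  · intro G _
    simp
  · intro t ht
    ext e
    rw [Finset.mem_powerset] at ht
    simp only [SimpleGraph.edgeSet_fromEdgeSet, mem_filter, mem_univ, true_and, Set.mem_sdiff,
      mem_coe]
    refine ⟨fun h => h.1, fun h => ⟨h, ?_⟩⟩
    have := ht h
    simpa using this
  · intro G _
    rw [Finset.prod_ite]
    congr 1
    · refine Finset.prod_congr ?_ fun _ _ => rfl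
      ext e
      simp only [mem_filter, mem_univ, true_and]
      exact ⟨fun h => h.2, fun h => ⟨G.not_isDiag_of_mem_edgeSet h, h⟩⟩
    · refine Finset.prod_congr ?_ fun _ _ => rfl
      ext e
      simp

theorem exists_randomGraph_singleton (n : ℕ) :
    ∃ c : ℝ, 0 ≤ c ∧ ∀ G : SimpleGraph (Fin n), (randomGraph n).real {G} = c := by
  refine ⟨(1 / 2) ^ (n.choose 2), by positivity, fun G => ?_⟩
  have h1 : G.edgeSet.ncard ≤ n.choose 2 := by
    have h2 : G.edgeSet ⊆ Sym2.diagSetᶜ := SimpleGraph.edgeSet_subset_compl_diagSet G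
    have h3 := Set.ncard_le_ncard h2
    have h6 : (Sym2.diagSetᶜ : Set (Sym2 (Fin n))).ncard = n.choose 2 := by
      rw [← Nat.card_coe_set_eq, Nat.card_eq_fintype_card, Sym2.card_diagSet_compl,
        Fintype.card_fin]
    rwa [h6] at h3
  have h4 : (unitInterval.toNNReal half : ℝ) = 1 / 2 := rfl
  have h5 : (unitInterval.toNNReal (unitInterval.symm half) : ℝ) = 1 / 2 := by
    change 1 - (1 / 2 : ℝ) = 1 / 2
    norm_num
  rw [randomGraph, measureReal_def, SimpleGraph.binomialRandom_singleton, Nat.card_eq_fintype_card,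
    Fintype.card_fin]
  simp only [ENNReal.toReal_mul, ENNReal.toReal_pow, ENNReal.coe_toReal, h4, h5]
  rw [← pow_add, Nat.add_sub_cancel' h1]

open scoped Classical in
theorem randomGraph_real_eq (n : ℕ) (P : Set (SimpleGraph (Fin n))) {c : ℝ}
    (hc : ∀ G : SimpleGraph (Fin n), (randomGraph n).real {G} = c) :
    (randomGraph n).real P = ∑ G : SimpleGraph (Fin n), if G ∈ P then c else 0 := by
  rw [← Finset.sum_filter]
  have := sum_measureReal_singleton (μ := randomGraph n) (univ.filter (· ∈ P))
  simp only [hc] at this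
  rw [this]
  congr 1
  ext G
  simp

open scoped Classical in
/-- Chernoff bound for a weighted sum of the edge signs of `G(n, 1/2)`. -/
theorem randomGraph_edgeSum_tail (n : ℕ) (w : Sym2 (Fin n) → ℝ) (t : ℝ) :
    (randomGraph n).real {G | t ≤ ∑ e ∈ univ.filter (fun e : Sym2 (Fin n) => ¬ e.IsDiag),
        (if e ∈ G.edgeSet then w e else -w e)}
      ≤ Real.exp (-t + (∑ e ∈ univ.filter (fun e : Sym2 (Fin n) => ¬ e.IsDiag), w e ^ 2) / 2) := by
  set E := univ.filter (fun e : Sym2 (Fin n) => ¬ e.IsDiag) with hE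
  obtain ⟨c, hc0, hc⟩ := exists_randomGraph_singleton n
  have hone : c * 2 ^ #E = 1 := by
    have h1 := randomGraph_real_eq n Set.univ hc
    rw [probReal_univ] at h1
    have h2 := sum_simpleGraph_prod n (fun _ => 1) (fun _ => 1)
    simp only [ite_self, prod_const_one, sum_const, prod_const, nsmul_eq_mul, mul_one] at h2
    simp only [Set.mem_univ, if_true, sum_const, nsmul_eq_mul] at h1
    rw [h1, h2, ← hE]
    norm_num [mul_comm]
  rw [randomGraph_real_eq n _ hc]
  calc (∑ G : SimpleGraph (Fin n), if G ∈ {G : SimpleGraph (Fin n) |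
          t ≤ ∑ e ∈ E, (if e ∈ G.edgeSet then w e else -w e)} then c else 0)
      ≤ ∑ G : SimpleGraph (Fin n), c * Real.exp (-t) *
          ∏ e ∈ E, (if e ∈ G.edgeSet then Real.exp (w e) else Real.exp (-w e)) := by
        refine Finset.sum_le_sum fun G _ => ?_
        have h1 : ∏ e ∈ E, (if e ∈ G.edgeSet then Real.exp (w e) else Real.exp (-w e))
            = Real.exp (∑ e ∈ E, (if e ∈ G.edgeSet then w e else -w e)) := by
          rw [Real.exp_sum]
          refine Finset.prod_congr rfl fun e _ => ?_
          split_ifs <;> rfl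
        rw [h1, mul_assoc, ← Real.exp_add]
        split_ifs with h
        · refine le_mul_of_one_le_right hc0 (Real.one_le_exp ?_)
          have : t ≤ ∑ e ∈ E, (if e ∈ G.edgeSet then w e else -w e) := h
          linarith
        · positivity
    _ = c * Real.exp (-t) * ∏ e ∈ E, (Real.exp (w e) + Real.exp (-w e)) := by
        rw [← Finset.mul_sum, hE, sum_simpleGraph_prod]
    _ ≤ c * Real.exp (-t) * ∏ e ∈ E, (2 * Real.exp (w e ^ 2 / 2)) := by
        gcongr with e _
        have := Real.cosh_le_exp_half_sq (w e)
        rw [Real.cosh_eq] at this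
        linarith
    _ = (c * 2 ^ #E) * Real.exp (-t + (∑ e ∈ E, w e ^ 2) / 2) := by
        rw [Finset.prod_mul_distrib, Finset.prod_const, ← Real.exp_sum, Real.exp_add,
          Finset.sum_div]
        ring
    _ = _ := by rw [hone, one_mul]

theorem sum_edges_eq (n : ℕ) (F : Fin n → Fin n → ℝ) (f : Sym2 (Fin n) → ℝ)
    (hf : ∀ u v, u ≠ v → f s(u, v) = F u v + F v u) :
    ∑ e ∈ univ.filter (fun e : Sym2 (Fin n) => ¬ e.IsDiag), f e
      = ∑ u, ∑ v, if u = v then 0 else F u v := by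
  have h1 := Finset.sum_sym2_filter_not_isDiag (univ : Finset (Fin n)) f
  rw [Finset.sym2_univ] at h1
  have h2 : ∑ e ∈ univ.filter (fun e : Sym2 (Fin n) => ¬ e.IsDiag), f e
      = ∑ p ∈ (univ : Finset (Fin n)).offDiag with p.1 < p.2, f s(p.1, p.2) := by
    rw [← h1]
  rw [h2]
  have h3 : ((univ : Finset (Fin n)).offDiag.filter fun p => p.1 < p.2)
      = (univ ×ˢ univ : Finset (Fin n × Fin n)).filter fun p => p.1 < p.2 := by
    ext p
    simp only [mem_filter, mem_offDiag, mem_univ, true_and, mem_product, and_iff_right_iff_imp]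
    exact fun h => h.ne
  rw [h3, Finset.sum_filter, Finset.sum_product]
  have h4 : ∀ u v : Fin n, (if u = v then 0 else F u v)
      = (if u < v then F u v else 0) + if v < u then F u v else 0 := by
    intro u v
    rcases lt_trichotomy u v with h | h | h
    · simp [h, h.ne, h.not_gt]
    · simp [h]
    · simp [h, h.ne', h.not_gt]
  simp_rw [h4, Finset.sum_add_distrib]
  conv_rhs => rw [add_comm, Finset.sum_comm]
  simp_rw [← Finset.sum_add_distrib]
  refine Finset.sum_congr rfl fun u _ => Finset.sum_congr rfl fun v _ => ?_
  split_ifs with h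
  · rw [hf u v h.ne, add_comm]
  · simp

/-- Chernoff bound for the bilinear form of the sign matrix. -/
theorem randomGraph_bilinear_tail (n : ℕ) (x y : Fin n → ℝ) (t : ℝ) :
    (randomGraph n).real {G | t ≤ ∑ u, ∑ v, signMatrix G u v * x u * y v}
      ≤ Real.exp (-t + (∑ u, x u ^ 2) * ∑ v, y v ^ 2) := by
  classical
  set w : Sym2 (Fin n) → ℝ := Sym2.lift ⟨fun u v => x u * y v + x v * y u, fun u v => add_comm _ _⟩
    with hw
  have hwm : ∀ u v, w s(u, v) = x u * y v + x v * y u := fun u v => rfl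
  have h1 : ∀ G : SimpleGraph (Fin n), ∑ u, ∑ v, signMatrix G u v * x u * y v
      = ∑ e ∈ univ.filter (fun e : Sym2 (Fin n) => ¬ e.IsDiag),
        (if e ∈ G.edgeSet then w e else -w e) := by
    intro G
    rw [sum_edges_eq n (fun u v => signMatrix G u v * x u * y v)]
    · refine Finset.sum_congr rfl fun u _ => Finset.sum_congr rfl fun v _ => ?_
      by_cases h : u = v <;> simp [h, signMatrix_diag]
    · intro u v huv
      rw [signMatrix_symm G v u, hwm]
      simp only [SimpleGraph.mem_edgeSet, signMatrix, if_neg huv]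
      split_ifs <;> ring
  have h2 : (∑ e ∈ univ.filter (fun e : Sym2 (Fin n) => ¬ e.IsDiag), w e ^ 2) / 2
      ≤ (∑ u, x u ^ 2) * ∑ v, y v ^ 2 := by
    have h3 : ∑ e ∈ univ.filter (fun e : Sym2 (Fin n) => ¬ e.IsDiag), w e ^ 2
        = ∑ u, ∑ v, if u = v then 0 else (x u * y v + x v * y u) ^ 2 / 2 := by
      refine sum_edges_eq n (fun u v => (x u * y v + x v * y u) ^ 2 / 2) _ fun u v _ => ?_
      rw [hwm]
      ring
    have h4 : ∑ u, ∑ v, (if u = v then 0 else (x u * y v + x v * y u) ^ 2 / 2)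
        ≤ ∑ u, ∑ v, ((x u ^ 2 * y v ^ 2) + (x v ^ 2 * y u ^ 2)) := by
      refine Finset.sum_le_sum fun u _ => Finset.sum_le_sum fun v _ => ?_
      split_ifs
      · positivity
      · nlinarith [sq_nonneg (x u * y v - x v * y u)]
    have h5 : ∑ u, ∑ v, ((x u ^ 2 * y v ^ 2) + (x v ^ 2 * y u ^ 2))
        = 2 * ((∑ u, x u ^ 2) * ∑ v, y v ^ 2) := by
      simp_rw [Finset.sum_add_distrib]
      have h6 : ∑ u, ∑ v, x v ^ 2 * y u ^ 2 = ∑ u, ∑ v, x u ^ 2 * y v ^ 2 := Finset.sum_comm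
      rw [h6, Finset.sum_mul_sum]
      ring
    rw [h3]
    linarith
  simp_rw [h1]
  refine (randomGraph_edgeSum_tail n w t).trans ?_
  gcongr

end RandomGraph

/-! ### Spectral norm of the sign matrix -/

section OperatorNorm

/-- A finite subset of the ball of radius `2` which computes norms by duality. -/
theorem exists_norming_net (n : ℕ) : ∃ N : Finset (EuclideanSpace ℝ (Fin n)), #N ≤ 5 ^ n ∧
    (∀ c ∈ N, ‖c‖ ≤ 2) ∧ ∀ z, ∃ c ∈ N, ‖z‖ ≤ inner ℝ c z := by
  classical
  set P : Finset (EuclideanSpace ℝ (Fin n)) → Prop := fun s =>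
    (∀ c ∈ s, ‖c‖ ≤ 2) ∧ ∀ c ∈ s, ∀ d ∈ s, c ≠ d → 1 ≤ ‖c - d‖ with hP
  have hcard : ∀ s, P s → #s ≤ 5 ^ n := fun s hs => by
    simpa using Besicovitch.card_le_of_separated s hs.1 hs.2
  -- A `1`-separated set in the ball of largest size, which exists because sizes are at most `5 ^
  -- n`; maximality makes it a net.
  set Q : ℕ → Prop := fun m => ∃ s, P s ∧ #s = m with hQ
  have hex : Q (Nat.findGreatest Q (5 ^ n)) :=
    Nat.findGreatest_spec (P := Q) (m := 0) (Nat.zero_le _) ⟨∅, by simp [hP], rfl⟩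
  obtain ⟨N, hN, hNcard⟩ := hex
  have hmax : ∀ y : EuclideanSpace ℝ (Fin n), ‖y‖ ≤ 2 → ∃ c ∈ N, ‖y - c‖ < 1 := by
    intro y hy
    by_contra hcon
    push Not at hcon
    have hyN : y ∉ N := fun h => by
      have := hcon y h
      simp at this
      linarith
    have hPi : P (insert y N) := by
      refine ⟨fun c hc => ?_, fun c hc d hd hcd => ?_⟩
      · rcases Finset.mem_insert.mp hc with rfl | hc
        · exact hy
        · exact hN.1 c hc
      · rcases Finset.mem_insert.mp hc with rfl | hc <;> rcases Finset.mem_insert.mp hd with rfl | hd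
        · exact absurd rfl hcd
        · exact hcon d ‹_›
        · rw [norm_sub_rev]
          exact hcon c ‹_›
        · exact hN.2 c hc d hd hcd
    have h1 := Nat.le_findGreatest (P := Q) (hcard _ hPi) ⟨_, hPi, rfl⟩
    rw [Finset.card_insert_of_notMem hyN, hNcard] at h1
    omega
  refine ⟨N, hcard N hN, hN.1, fun z => ?_⟩
  by_cases hz : z = 0
  · obtain ⟨c, hc, _⟩ := hmax 0 (by simp)
    exact ⟨c, hc, by simp [hz]⟩
  have hz0 : 0 < ‖z‖ := norm_pos_iff.mpr hz
  -- Radius `2` leaves room: a net point within `1` of `y` has inner product with `z` at least `2 *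
  -- ‖z‖ - ‖z‖`.
  set y : EuclideanSpace ℝ (Fin n) := (2 / ‖z‖) • z with hy
  have hynorm : ‖y‖ = 2 := by
    rw [hy, norm_smul, Real.norm_of_nonneg (by positivity), div_mul_cancel₀ _ hz0.ne']
  obtain ⟨c, hc, hyc⟩ := hmax y hynorm.le
  refine ⟨c, hc, ?_⟩
  have h1 : inner ℝ y z = 2 * ‖z‖ := by
    rw [hy, real_inner_smul_left, real_inner_self_eq_norm_sq]
    field_simp
  have h2 : inner ℝ (y - c) z ≤ ‖z‖ := by
    refine (real_inner_le_norm _ _).trans ?_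
    nlinarith
  rw [inner_sub_left, h1] at h2
  linarith

/-- Duality against the net is used twice: first to bound `L c` for net points `c`, then to bound `R
y` for arbitrary `y`. -/
theorem bilinear_le_of_net {n : ℕ} {N : Finset (EuclideanSpace ℝ (Fin n))}
    (hN : ∀ z, ∃ c ∈ N, ‖z‖ ≤ inner ℝ c z) {χ : Fin n → Fin n → ℝ} {t : ℝ}
    (h : ∀ c ∈ N, ∀ d ∈ N, ∑ u, ∑ v, χ u v * c u * d v ≤ t) (x y : Fin n → ℝ) :
    |∑ u, ∑ v, χ u v * x u * y v| ≤ t * √(∑ u, x u ^ 2) * √(∑ v, y v ^ 2) := by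
  have hnorm : ∀ x : Fin n → ℝ, √(∑ u, x u ^ 2) = ‖(WithLp.toLp 2 x : EuclideanSpace ℝ (Fin n))‖ := by
    intro x
    simp [EuclideanSpace.norm_eq]
  rw [hnorm, hnorm]
  set X : EuclideanSpace ℝ (Fin n) := WithLp.toLp 2 x with hX
  set Y : EuclideanSpace ℝ (Fin n) := WithLp.toLp 2 y with hY
  set R : (Fin n → ℝ) → EuclideanSpace ℝ (Fin n) := fun d => WithLp.toLp 2 fun u => ∑ v, χ u v * d v
    with hR
  set L : (Fin n → ℝ) → EuclideanSpace ℝ (Fin n) := fun c => WithLp.toLp 2 fun v => ∑ u, χ u v * c u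
    with hL
  have hRi : ∀ (c : EuclideanSpace ℝ (Fin n)) (d : Fin n → ℝ), inner ℝ c (R d)
      = ∑ u, ∑ v, χ u v * c u * d v := by
    intro c d
    simp only [hR, PiLp.inner_apply, RCLike.inner_apply, conj_trivial, Finset.sum_mul]
    refine Finset.sum_congr rfl fun u _ => Finset.sum_congr rfl fun v _ => ?_
    ring
  have hLi : ∀ (c : Fin n → ℝ) (d : EuclideanSpace ℝ (Fin n)), inner ℝ d (L c)
      = ∑ u, ∑ v, χ u v * c u * d v := by
    intro c d
    simp only [hL, PiLp.inner_apply, RCLike.inner_apply, conj_trivial, Finset.sum_mul]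
    rw [Finset.sum_comm]
  have h1 : ∀ c ∈ N, ‖L c‖ ≤ t := by
    intro c hc
    obtain ⟨d, hd, hcd⟩ := hN (L c)
    rw [hLi] at hcd
    exact hcd.trans (h c hc d hd)
  have h2 : ‖R y‖ ≤ t * ‖Y‖ := by
    obtain ⟨c, hc, hcy⟩ := hN (R y)
    refine hcy.trans ?_
    have e : inner ℝ c (R y) = inner ℝ Y (L c) := by rw [hRi, hLi]
    rw [e]
    refine (real_inner_le_norm _ _).trans ?_
    rw [mul_comm]
    gcongr
    exact h1 c hc
  have e : ∑ u, ∑ v, χ u v * x u * y v = inner ℝ X (R y) := by rw [hRi]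
  rw [e]
  refine (abs_real_inner_le_norm _ _).trans ?_
  calc ‖X‖ * ‖R y‖ ≤ ‖X‖ * (t * ‖Y‖) := by gcongr
    _ = _ := by ring

theorem randomGraph_not_opNorm_le (n : ℕ) :
    (randomGraph n).real {G | ¬ ∀ x y : Fin n → ℝ, |∑ u, ∑ v, signMatrix G u v * x u * y v|
      ≤ 21 * √n * √(∑ u, x u ^ 2) * √(∑ v, y v ^ 2)} ≤ Real.exp (-n) := by
  obtain ⟨N, hcard, hnorm, hnet⟩ := exists_norming_net n
  -- The factor `√n` is the Chernoff parameter. Net points have norm at most `2`, so the exponent is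
  -- at most `-21 * n + 16 * n`, and the union over `25 ^ n ≤ exp (4 * n)` pairs leaves `exp (-n)`.
  have hpair : ∀ p ∈ N ×ˢ N, (randomGraph n).real
      {G | 21 * (n : ℝ) ≤ ∑ u, ∑ v, signMatrix G u v * (√n * p.1 u) * p.2 v}
      ≤ Real.exp (-(5 * n)) := by
    intro p hp
    rw [Finset.mem_product] at hp
    refine (randomGraph_bilinear_tail n _ _ _).trans ?_
    rw [Real.exp_le_exp]
    have h1 : ∑ u, (√n * p.1 u) ^ 2 = n * ‖p.1‖ ^ 2 := by
      rw [EuclideanSpace.norm_sq_eq, Finset.mul_sum]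
      refine Finset.sum_congr rfl fun u _ => ?_
      rw [mul_pow, Real.sq_sqrt (Nat.cast_nonneg n), Real.norm_eq_abs, sq_abs]
    have h2 : ∑ v, p.2 v ^ 2 = ‖p.2‖ ^ 2 := by
      rw [EuclideanSpace.norm_sq_eq]
      simp
    rw [h1, h2]
    have h3 : ‖p.1‖ ^ 2 ≤ 4 := by nlinarith [hnorm _ hp.1, norm_nonneg p.1]
    have h4 : ‖p.2‖ ^ 2 ≤ 4 := by nlinarith [hnorm _ hp.2, norm_nonneg p.2]
    have h5 : (n : ℝ) * ‖p.1‖ ^ 2 * ‖p.2‖ ^ 2 ≤ n * 4 * 4 := by gcongr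
    linarith
  have hsub : {G : SimpleGraph (Fin n) | ¬ ∀ x y : Fin n → ℝ,
      |∑ u, ∑ v, signMatrix G u v * x u * y v|
      ≤ 21 * √n * √(∑ u, x u ^ 2) * √(∑ v, y v ^ 2)} ⊆
      ⋃ p ∈ N ×ˢ N, {G | 21 * (n : ℝ) ≤ ∑ u, ∑ v, signMatrix G u v * (√n * p.1 u) * p.2 v} := by
    intro G hG
    by_contra hcon
    refine hG fun x y => ?_
    refine bilinear_le_of_net hnet (fun c hc d hd => ?_) x y
    simp only [Set.mem_iUnion, not_exists] at hcon
    have h1 := hcon (c, d) (by simp [hc, hd])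
    simp only [Set.mem_ofPred_eq, not_le] at h1
    have h2 : ∑ u, ∑ v, signMatrix G u v * (√n * c u) * d v
        = √n * ∑ u, ∑ v, signMatrix G u v * c u * d v := by
      simp_rw [Finset.mul_sum]
      refine Finset.sum_congr rfl fun u _ => Finset.sum_congr rfl fun v _ => ?_
      ring
    rw [h2] at h1
    have hs : 0 ≤ √(n : ℝ) := Real.sqrt_nonneg _
    have hss : √(n : ℝ) * √n = n := Real.mul_self_sqrt (Nat.cast_nonneg n)
    rcases hs.eq_or_lt with h0 | h0
    · rw [← h0] at hss
      have hn : n = 0 := by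
        have : (n : ℝ) = 0 := by linarith
        exact_mod_cast this
      subst hn
      simp
    · by_contra hlt
      push Not at hlt
      nlinarith
  calc (randomGraph n).real _
      ≤ (randomGraph n).real (⋃ p ∈ N ×ˢ N,
          {G | 21 * (n : ℝ) ≤ ∑ u, ∑ v, signMatrix G u v * (√n * p.1 u) * p.2 v}) :=
        measureReal_mono hsub (measure_ne_top _ _)
    _ ≤ ∑ p ∈ N ×ˢ N, (randomGraph n).real
          {G | 21 * (n : ℝ) ≤ ∑ u, ∑ v, signMatrix G u v * (√n * p.1 u) * p.2 v} :=
        measureReal_biUnion_finset_le _ _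
    _ ≤ ∑ p ∈ N ×ˢ N, Real.exp (-(5 * n)) := Finset.sum_le_sum hpair
    _ = (#N : ℝ) * #N * Real.exp (-(5 * n)) := by
        rw [Finset.sum_const, Finset.card_product, nsmul_eq_mul]
        push_cast
        ring
    _ ≤ 5 ^ n * 5 ^ n * Real.exp (-(5 * n)) := by
        have : (#N : ℝ) ≤ 5 ^ n := by exact_mod_cast hcard
        gcongr
    _ = 25 ^ n * Real.exp (-(5 * n)) := by
        rw [← mul_pow]
        norm_num
    _ ≤ Real.exp 4 ^ n * Real.exp (-(5 * n)) := by
        gcongr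
        have h1 := Real.exp_one_gt_d9
        have h2 : Real.exp 4 = Real.exp 1 ^ 4 := by
          rw [← Real.exp_nat_mul]
          norm_num
        rw [h2]
        calc (25 : ℝ) ≤ 2.7 ^ 4 := by norm_num
          _ ≤ Real.exp 1 ^ 4 := by
            gcongr
            linarith
    _ = Real.exp (-n) := by
        rw [← Real.exp_nat_mul, ← Real.exp_add]
        congr 1
        ring

end OperatorNorm

/-! ### Logarithmic clique number -/

section CliqueNumber

theorem sum_signMatrix_of_isClique {n : ℕ} {G : SimpleGraph (Fin n)} {Q : Finset (Fin n)}
    (hQ : G.IsClique (Q : Set (Fin n))) (a : ℝ) :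
    ∑ u, ∑ v, signMatrix G u v * (if u ∈ Q then a else 0) * (if v ∈ Q then 1 else 0)
      = a * (#Q * (#Q - 1)) := by
  have h1 : ∀ u ∈ Q, ∑ v, signMatrix G u v * (if u ∈ Q then a else 0) * (if v ∈ Q then 1 else 0)
      = a * (#Q - 1) := by
    intro u hu
    have h2 : ∀ v, signMatrix G u v * (if u ∈ Q then a else 0) * (if v ∈ Q then (1 : ℝ) else 0)
        = if v ∈ Q.erase u then a else 0 := by
      intro v
      by_cases huv : u = v
      · simp [huv, signMatrix_diag]
      by_cases hv : v ∈ Q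
      · simp [signMatrix, huv, Ne.symm huv, hv, hu, hQ hu hv huv]
      · simp [hv]
    simp_rw [h2]
    rw [Finset.sum_ite_mem, Finset.univ_inter, Finset.sum_const, Finset.card_erase_of_mem hu,
      nsmul_eq_mul, Nat.cast_sub (Finset.card_pos.mpr ⟨u, hu⟩)]
    push_cast
    ring
  have h3 : ∀ u ∉ Q, ∑ v, signMatrix G u v * (if u ∈ Q then a else 0) *
      (if v ∈ Q then (1 : ℝ) else 0) = 0 := by
    intro u hu
    simp [hu]
  rw [← Finset.sum_subset (Finset.subset_univ Q) fun u _ hu => h3 u hu, Finset.sum_congr rfl h1,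
    Finset.sum_const, nsmul_eq_mul]
  ring

/-- A clique makes the bilinear form on its indicator as large as possible, so the Chernoff bound
applies, with parameter `1 / 4`. Its exponent `-m * (m - 1) / 4 + m ^ 2 / 16` is at most `-m ^ 2 /
16`, and `m ≥ 32 * log n` beats the `n ^ m` candidate sets. -/
theorem randomGraph_le_cliqueNum {n m : ℕ} (hn : 1 ≤ n) (hm : 2 ≤ m)
    (hnm : 32 * Real.log n ≤ m) :
    (randomGraph n).real {G | m ≤ G.cliqueNum} ≤ (n : ℝ)⁻¹ := by
  have hn0 : (0 : ℝ) < n := by exact_mod_cast hn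
  have hm0 : (2 : ℝ) ≤ m := by exact_mod_cast hm
  have hlog : 0 ≤ Real.log n := Real.log_natCast_nonneg n
  set B : Finset (Fin n) → Set (SimpleGraph (Fin n)) := fun Q =>
    {G | 1 / 4 * ((m : ℝ) * (m - 1)) ≤
      ∑ u, ∑ v, signMatrix G u v * (if u ∈ Q then 1 / 4 else 0) * (if v ∈ Q then 1 else 0)} with hB
  have hsub : {G : SimpleGraph (Fin n) | m ≤ G.cliqueNum} ⊆ ⋃ Q ∈ powersetCard m univ, B Q := by
    intro G hG
    obtain ⟨Q, hQ⟩ := G.exists_isNClique_cliqueNum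
    obtain ⟨Q', hsub, hcard⟩ := Finset.exists_subset_card_eq (hQ.card_eq.symm ▸ hG : m ≤ #Q)
    simp only [Set.mem_iUnion]
    refine ⟨Q', by simp [Finset.mem_powersetCard, hcard], ?_⟩
    simp only [hB, Set.mem_ofPred_eq]
    rw [sum_signMatrix_of_isClique (hQ.isClique.subset (by exact_mod_cast hsub)), hcard]
  have hone : ∀ Q ∈ powersetCard m (univ : Finset (Fin n)),
      (randomGraph n).real (B Q) ≤ Real.exp (-(m ^ 2 / 16)) := by
    intro Q hQ
    have hcard := (Finset.mem_powersetCard.mp hQ).2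
    refine (randomGraph_bilinear_tail n _ _ _).trans ?_
    rw [Real.exp_le_exp]
    have e1 : ∑ u, (if u ∈ Q then (1 / 4 : ℝ) else 0) ^ 2 = m / 16 := by
      simp only [ite_pow, ne_eq, OfNat.ofNat_ne_zero, not_false_eq_true, zero_pow,
        Finset.sum_ite_mem, Finset.univ_inter, Finset.sum_const, hcard, nsmul_eq_mul]
      ring
    have e2 : ∑ v, (if v ∈ Q then (1 : ℝ) else 0) ^ 2 = m := by
      simp [ite_pow, hcard]
    rw [e1, e2]
    nlinarith
  calc (randomGraph n).real {G | m ≤ G.cliqueNum}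
      ≤ (randomGraph n).real (⋃ Q ∈ powersetCard m univ, B Q) := measureReal_mono hsub (measure_ne_top _ _)
    _ ≤ ∑ Q ∈ powersetCard m (univ : Finset (Fin n)), (randomGraph n).real (B Q) :=
        measureReal_biUnion_finset_le _ _
    _ ≤ ∑ Q ∈ powersetCard m (univ : Finset (Fin n)), Real.exp (-(m ^ 2 / 16)) :=
        Finset.sum_le_sum hone
    _ = (n.choose m : ℝ) * Real.exp (-(m ^ 2 / 16)) := by
        rw [Finset.sum_const, Finset.card_powersetCard, Finset.card_univ, Fintype.card_fin,
          nsmul_eq_mul]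
    _ ≤ (n : ℝ) ^ m * Real.exp (-(m ^ 2 / 16)) := by
        gcongr
        exact_mod_cast Nat.choose_le_pow n m
    _ = Real.exp (m * Real.log n - m ^ 2 / 16) := by
        rw [sub_eq_add_neg, Real.exp_add, Real.exp_nat_mul, Real.exp_log hn0]
    _ ≤ Real.exp (-Real.log n) := by
        rw [Real.exp_le_exp]
        nlinarith
    _ = (n : ℝ)⁻¹ := by rw [Real.exp_neg, Real.exp_log hn0]

end CliqueNumber

end MaxCliqueSOS

namespace MaxCliqueSOS

open Finset MeasureTheory

/-! ### Choice of constants and conclusion -/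

theorem rounds_constant_le {r : ℕ} (hr : 1 ≤ r) :
    (18 * r * 2 ^ (2 * r ^ 2 + 3 * r) * 21 : ℝ) ≤ ((2 ^ 15) ^ r) ^ r := by
  have h1 : (r : ℝ) ≤ 2 ^ (r ^ 2) := by
    have h2 : r ≤ 2 ^ (r ^ 2) :=
      (Nat.lt_two_pow_self (n := r)).le.trans
        (Nat.pow_le_pow_right (by norm_num) (Nat.le_self_pow (by norm_num) r))
    exact_mod_cast h2
  have hr2 : 1 ≤ r ^ 2 := Nat.one_le_pow _ _ hr
  have hrr : r ≤ r ^ 2 := Nat.le_self_pow (by norm_num) r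
  calc (18 * r * 2 ^ (2 * r ^ 2 + 3 * r) * 21 : ℝ)
      = 378 * r * 2 ^ (2 * r ^ 2 + 3 * r) := by ring
    _ ≤ 2 ^ (9 * r ^ 2) * 2 ^ (r ^ 2) * 2 ^ (2 * r ^ 2 + 3 * r ^ 2) := by
        gcongr
        · calc (378 : ℝ) ≤ 2 ^ (9 * 1) := by norm_num
            _ ≤ 2 ^ (9 * r ^ 2) := by
              gcongr
              norm_num
        · norm_num
    _ = ((2 ^ 15) ^ r) ^ r := by
        rw [← pow_add, ← pow_add, ← pow_mul, ← pow_mul]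
        congr 1
        ring

theorem one_le_cliqueNum {n : ℕ} (hn : 1 ≤ n) (G : SimpleGraph (Fin n)) : 1 ≤ G.cliqueNum := by
  have h : G.IsClique (({⟨0, hn⟩} : Finset (Fin n)) : Set (Fin n)) := by simp
  simpa using h.card_le_cliqueNum

theorem le_fullIntegralityGap {n r : ℕ} (hr : 1 ≤ r) {G : SimpleGraph (Fin n)}
    (hlog : 1 ≤ Real.log n) (hω : (G.cliqueNum : ℝ) ≤ 33 * Real.log n)
    (hop : ∀ x y : Fin n → ℝ, |∑ u, ∑ v, signMatrix G u v * x u * y v|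
      ≤ 21 * √n * √(∑ u, x u ^ 2) * √(∑ v, y v ^ 2)) :
    (n : ℝ) ^ (1 / (2 * (r : ℝ))) / ((33 * 2 ^ 15) ^ r * Real.log n ^ 2)
      ≤ fullIntegralityGap G r := by
  have hn1 : 1 ≤ n := by
    by_contra h
    have : n = 0 := by omega
    subst this
    norm_num at hlog
  have hn : (1 : ℝ) ≤ n := by exact_mod_cast hn1
  have hω1 : (1 : ℝ) ≤ G.cliqueNum := by exact_mod_cast one_le_cliqueNum hn1 G
  -- Then `k ^ r = √n / 2 ^ (15 * r ^ 2)`: one `√n` comes from here, the other from `Λ`, and the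
  -- denominator absorbs all constants depending on `r`.
  set k : ℝ := (n : ℝ) ^ (1 / (2 * (r : ℝ))) / (2 ^ 15) ^ r with hk
  have hpow0 : 0 ≤ (n : ℝ) ^ (1 / (2 * (r : ℝ))) := by positivity
  have hk0 : 0 ≤ k := by positivity
  have h33 : (33 : ℝ) ≤ 33 ^ r := le_self_pow₀ (by norm_num) (by omega)
  have hthr : (n : ℝ) ^ (1 / (2 * (r : ℝ))) / ((33 * 2 ^ 15) ^ r * Real.log n ^ 2)
      ≤ k / (33 * Real.log n) := by
    rw [hk, div_div, mul_pow (33 : ℝ)]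
    refine div_le_div_of_nonneg_left hpow0 (by positivity) ?_
    calc (2 ^ 15 : ℝ) ^ r * (33 * Real.log n) = 33 * (2 ^ 15) ^ r * (Real.log n * 1) := by ring
      _ ≤ 33 ^ r * (2 ^ 15) ^ r * (Real.log n * Real.log n) := by gcongr
      _ = _ := by ring
  refine hthr.trans ?_
  unfold fullIntegralityGap
  -- The moment construction needs `1 ≤ k`; below that the claimed bound is at most `1` and the true
  -- clique solution suffices.
  by_cases hk1 : k < 1
  · calc k / (33 * Real.log n) ≤ 1 := by
          rw [div_le_one (by positivity)]
          linarith
      _ ≤ fullSOSValue G r / G.cliqueNum := by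
          rw [one_le_div (by linarith)]
          exact cliqueNum_le_fullSOSValue G hr
  · push Not at hk1
    have hval : k ≤ fullSOSValue G r := by
      have hs1 : 1 ≤ √(n : ℝ) := Real.one_le_sqrt.mpr hn
      refine le_fullSOSValue G (Λ := 21 * √n) (by linarith) hop hr hk1 ?_
      have hkr : k ^ r = √n / ((2 ^ 15) ^ r) ^ r := by
        rw [hk, div_pow, ← Real.rpow_natCast ((n : ℝ) ^ (1 / (2 * (r : ℝ)))),
          ← Real.rpow_mul (by positivity), Real.sqrt_eq_rpow]
        congr 2
        have : (r : ℝ) ≠ 0 := by exact_mod_cast (by omega : r ≠ 0)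
        field_simp
      rw [hkr, Fintype.card_fin]
      have hss : √(n : ℝ) * √n = n := Real.mul_self_sqrt (Nat.cast_nonneg n)
      calc 18 * r * 2 ^ (2 * r ^ 2 + 3 * r) * (21 * √n) * (√n / ((2 ^ 15) ^ r) ^ r)
          = (18 * r * 2 ^ (2 * r ^ 2 + 3 * r) * 21) / ((2 ^ 15) ^ r) ^ r * (√n * √n) := by ring
        _ ≤ 1 * (√n * √n) := by
            gcongr
            exact (div_le_one (by positivity)).mpr (rounds_constant_le hr)
        _ = n := by rw [one_mul, hss]
    calc k / (33 * Real.log n) ≤ k / G.cliqueNum := by gcongr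
      _ ≤ fullSOSValue G r / G.cliqueNum := by gcongr

theorem one_sub_le_randomGraph_real {n : ℕ} (hlog : 1 ≤ Real.log n) {P : Set (SimpleGraph (Fin n))}
    (hP : ∀ G : SimpleGraph (Fin n), (G.cliqueNum : ℝ) ≤ 33 * Real.log n →
      (∀ x y : Fin n → ℝ, |∑ u, ∑ v, signMatrix G u v * x u * y v|
        ≤ 21 * √n * √(∑ u, x u ^ 2) * √(∑ v, y v ^ 2)) → G ∈ P) :
    1 - Real.exp (-n) - (n : ℝ)⁻¹ ≤ (randomGraph n).real P := by
  have hn1 : 1 ≤ n := by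
    by_contra h
    have : n = 0 := by omega
    subst this
    norm_num at hlog
  -- Rounding up costs less than `1 ≤ log n`, whence the constant `33`.
  set m := ⌈32 * Real.log n⌉₊ with hm
  have hm1 : 32 * Real.log n ≤ m := Nat.le_ceil _
  have hm2 : (m : ℝ) < 32 * Real.log n + 1 := Nat.ceil_lt_add_one (by positivity)
  have hm3 : 2 ≤ m := by
    have : (2 : ℝ) ≤ m := by linarith
    exact_mod_cast this
  set B₁ : Set (SimpleGraph (Fin n)) := {G | ¬ ∀ x y : Fin n → ℝ,
    |∑ u, ∑ v, signMatrix G u v * x u * y v|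
      ≤ 21 * √n * √(∑ u, x u ^ 2) * √(∑ v, y v ^ 2)} with hB₁
  set B₂ : Set (SimpleGraph (Fin n)) := {G | m ≤ G.cliqueNum} with hB₂
  have hcover : (Set.univ : Set (SimpleGraph (Fin n))) ⊆ P ∪ (B₁ ∪ B₂) := by
    intro G _
    by_cases h1 : G ∈ B₁
    · exact Or.inr (Or.inl h1)
    by_cases h2 : G ∈ B₂
    · exact Or.inr (Or.inr h2)
    refine Or.inl (hP G ?_ (not_not.mp h1))
    have h3 : G.cliqueNum < m := not_le.mp h2
    have h4 : (G.cliqueNum : ℝ) ≤ m := by exact_mod_cast h3.le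
    linarith
  have h1 := measureReal_mono (μ := randomGraph n) hcover (measure_ne_top _ _)
  rw [probReal_univ] at h1
  have h2 := measureReal_union_le (μ := randomGraph n) P (B₁ ∪ B₂)
  have h3 := measureReal_union_le (μ := randomGraph n) B₁ B₂
  have h4 : (randomGraph n).real B₁ ≤ Real.exp (-n) := randomGraph_not_opNorm_le n
  have h5 : (randomGraph n).real B₂ ≤ (n : ℝ)⁻¹ := randomGraph_le_cliqueNum hn1 hm3 hm1
  linarith

end MaxCliqueSOS

theorem theorem1p1 :
    ∃ C : ℝ, 0 < C ∧ ∀ r : ℕ → ℕ, (∀ n, 1 ≤ r n) →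
      Filter.Tendsto
        (fun n : ℕ => MaxCliqueSOS.randomGraph n
          {G | (n : ℝ) ^ (1 / (2 * (r n : ℝ))) / (C ^ (r n) * Real.log n ^ 2)
                ≤ MaxCliqueSOS.integralityGap G (r n) ∧
              (n : ℝ) ^ (1 / (2 * (r n : ℝ))) / (C ^ (r n) * Real.log n ^ 2)
                ≤ MaxCliqueSOS.fullIntegralityGap G (r n)})
        Filter.atTop (nhds 1) := by
  -- The factor `33` pays for the clique number and `2 ^ 15` for the constants in the positivity
  -- condition.
  refine ⟨33 * 2 ^ 15, by norm_num, fun r hr => ?_⟩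
  have hlog : ∀ᶠ n : ℕ in Filter.atTop, 1 ≤ Real.log n :=
    (Real.tendsto_log_atTop.comp tendsto_natCast_atTop_atTop).eventually_ge_atTop 1
  have hlim : Filter.Tendsto (fun n : ℕ => 1 - Real.exp (-n) - (n : ℝ)⁻¹) Filter.atTop
      (nhds 1) := by
    have h1 : Filter.Tendsto (fun n : ℕ => Real.exp (-(n : ℝ))) Filter.atTop (nhds 0) :=
      Real.tendsto_exp_neg_atTop_nhds_zero.comp tendsto_natCast_atTop_atTop
    have h2 := ((tendsto_const_nhds (x := (1 : ℝ))).sub h1).sub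
      (tendsto_inv_atTop_nhds_zero_nat (𝕜 := ℝ))
    simpa using h2
  have hreal : Filter.Tendsto (fun n : ℕ => (MaxCliqueSOS.randomGraph n).real
      {G | (n : ℝ) ^ (1 / (2 * (r n : ℝ))) / ((33 * 2 ^ 15) ^ (r n) * Real.log n ^ 2)
            ≤ MaxCliqueSOS.integralityGap G (r n) ∧
          (n : ℝ) ^ (1 / (2 * (r n : ℝ))) / ((33 * 2 ^ 15) ^ (r n) * Real.log n ^ 2)
            ≤ MaxCliqueSOS.fullIntegralityGap G (r n)}) Filter.atTop (nhds 1) := by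
    refine tendsto_of_tendsto_of_tendsto_of_le_of_le' hlim tendsto_const_nhds ?_
      (Filter.Eventually.of_forall fun n => MeasureTheory.measureReal_le_one)
    filter_upwards [hlog] with n hn
    refine MaxCliqueSOS.one_sub_le_randomGraph_real hn fun G hω hop => ?_
    have h := MaxCliqueSOS.le_fullIntegralityGap (hr n) hn hω hop
    exact ⟨h.trans (MaxCliqueSOS.fullIntegralityGap_le_integralityGap G (hr n)), h⟩
  have := ENNReal.tendsto_ofReal hreal
  rw [ENNReal.ofReal_one] at this
  exact this.congr fun n => MeasureTheory.ofReal_measureReal (MeasureTheory.measure_ne_top _ _)
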